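/- **Setting.** Let $n\ge 1$ and let $(M^{2n+2},g)$ be a smooth Riemannian manifold with a proper, smooth, isometric, cohomogeneity one action of a Lie group $\mathcal G$ of dimension $2n+1$. On an open set $U\subset M$ let there be given a function $t:U\to S$ onto an open interval $S$, whose level sets are locally the $\mathcal G$-orbits, and a smooth (locally) $\mathcal G$-invariant frame $\partial_t, Z, X_1,\dots,X_n,Y_1,\dots,Y_n$ with $dt(\partial_t)=1$ and $Z,X_i,Y_i$ tangent to the orbits. Suppose that for some real constants $\Gamma_{ii}^z,\Gamma_{iz}^i,\Gamma_{zi}^i$ $$[X_i,Y_i]=-\Gamma_{ii}^zZ,\qquad [Y_i,Z]=-\Gamma_{iz}^iX_i,\qquad [Z,X_i]=-\Gamma_{zi}^iY_i,$$ and all other brackets of frame fields vanish (no summation convention). Let $\zeta,\sigma_i,\rho_i$ be the forms which together with $dt$ form the coframe dual to $\partial_t,Z,X_i,Y_i$, and suppose that on $U$ $$g=\Big(\prod_{i=1}^n(a_ib_i)^2\Big)c^2\,dt^2+c^2\zeta^2+\sum_{i=1}^n\big(a_i^2\sigma_i^2+b_i^2\rho_i^2\big)$$ with $a_i,b_i,c$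 positive smooth functions of $t\in S$. Let $J$ be the almost complex structure on $U$ with $J\partial_t=\big(\prod_i a_ib_i\big)Z$ and $JX_i=\frac{a_i}{b_i}Y_i$. Put $\alpha=\big(\prod_{i}a_ib_i\big)c$, let $\tau=\tau(t)$ solve $\tau'(t)=\sqrt2\big(\prod_i a_ib_i\big)c$, and let $f=f(\tau)$ be a smooth function on $\tau(S)$, regarded also as a function $f(\tau(t))$ of $t$ and as a function on $U$. In the equations below a prime is $d/dt$; they are required for all $t\in S$ and all $i$. **Definitions.** Let $\omega=g(J\cdot,\cdot)$ and $\rho=\mathrm{Ric}(J\cdot,\cdot)$, and let $\lambda\in\mathbb R$. The pair $(g,f)$ is a *Kähler–Ricci skew-soliton* with soliton constant $\lambda$ if $(g,J)$ is Kähler and $$\rho(v,w)+\tfrac12\big(\nabla df(Jv,w)-\nabla df(Jw,v)\big)=\lambda\,\omega(v,w)$$ for all tangent vectors $v,w$ at a common point. The metric $g$ is a *Kähler–Ricci soliton metric with soliton potential $f$* (and soliton constant $\lambda$) if $(g,J)$ is Kähler, $\nabla f$ is holomorphic ($\mathcal L_{\nabla f}J=0$) and $\rho+\frac12\mathcal L_{\nabla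 f}\omega=\lambda\omega$. **Proposition 4.1.** Let $\lambda\neq0$ and $\Gamma_{ii}^z\ne0$ for all $i$. (a) Suppose that $$\frac{a_i'}{a_i}+\frac{b_i'}{b_i}=\Gamma_{ii}^z\frac{\alpha c}{a_ib_i},\qquad \frac{b_i'}{b_i}-\frac{a_i'}{a_i}=\Big(\Gamma_{iz}^i\frac{a_i}{b_i}-\Gamma_{zi}^i\frac{b_i}{a_i}\Big)\frac{\alpha}{c},$$ that $\Gamma_{ii}^z(a_ib_i)^{-1}$ is independent of $i$, and that $$\frac{c'}{c}=\alpha\Big[\sum_{j=1}^n\frac1{2a_jb_j}\Big(\frac1c\big(\Gamma_{jz}^ja_j^2+\Gamma_{zj}^jb_j^2\big)-\Gamma_{jj}^zc\Big)-\frac{\lambda}{\Gamma_{ii}^z}\frac{a_ib_i}{c}\Big]+\frac12f'.$$ Then $(g,f(\tau))$ is a Kähler–Ricci skew-soliton on $U$ with soliton constant $\lambda$. (b) Suppose in addition that $\Gamma_{iz}^ia_i^2-\Gamma_{zi}^ib_i^2=0$ for all $i$ and that $f'=k\alpha c$ for a constant $k$. Then there are constants $\ell_i>0$ with $b_i=\ell_ia_i$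 and $\Gamma_{iz}^i-\ell_i^2\Gamma_{zi}^i=0$, $i=1,\dots,n$, such that $$\frac{c'}{c}=\alpha\Big[\sum_{j=1}^n\frac1{2\ell_ja_j^2}\Big(\frac2c\Gamma_{jz}^ja_j^2-\Gamma_{jj}^zc\Big)-\frac{\lambda}{\Gamma_{ii}^z}\frac{\ell_ia_i^2}{c}+\frac12kc\Big],\qquad \frac{a_i'}{a_i}=\frac{\Gamma_{ii}^z}{2}\frac{\alpha c}{\ell_ia_i^2}.$$ (c) If, furthermore, every critical point of the one-variable function $f(\tau)$ is degenerate (i.e. $\frac{df}{d\tau}=0$ implies $\frac{d^2f}{d\tau^2}=0$), then $g$ is a Kähler–Ricci soliton metric on $U$ with soliton potential $f$ (and soliton constant $\lambda$). -/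

import Mathlib

open Set Bundle FiberBundle VectorField
open scoped Manifold ContDiff Topology

noncomputable section

namespace KRSkew

section Geometry

variable {E : Type*} [NormedAddCommGroup E] [NormedSpace ℝ E] [FiniteDimensional ℝ E]
  {H : Type*} [TopologicalSpace H] {I : ModelWithCorners ℝ E H}
  {M : Type*} [TopologicalSpace M] [ChartedSpace H M] [IsManifold I ∞ M]

/-- `cov` is the Levi-Civita connection of `g`: torsion-free and metric. In Mathlib's argument
order `cov σ x v` is `∇_v σ` at `x`. -/
structure IsLeviCivita (g : ContMDiffRiemannianMetric I ∞ E (fun x : M ↦ TangentSpace I x))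
    (cov : CovariantDerivative I E (fun x : M ↦ TangentSpace I x)) : Prop where
  torsion_eq_zero : cov.torsion = 0
  metric : ∀ (x : M) (v : TangentSpace I x) (Y Z : Π x : M, TangentSpace I x),
    MDiffAt (T% Y) x → MDiffAt (T% Z) x →
      d% (fun y ↦ g.inner y (Y y) (Z y)) x v =
        g.inner x (cov Y x v) (Z x) + g.inner x (Y x) (cov Z x v)

/-- `R(X,Y)Z = ∇_X ∇_Y Z - ∇_Y ∇_X Z - ∇_[X,Y] Z` for vector fields. -/
def curvature (cov : CovariantDerivative I E (fun x : M ↦ TangentSpace I x))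
    (X Y Z : Π x : M, TangentSpace I x) (x : M) : TangentSpace I x :=
  cov (fun y ↦ cov Z y (Y y)) x (X x) - cov (fun y ↦ cov Z y (X y)) x (Y x)
    - cov Z x (mlieBracket I X Y x)

/-- Ricci tensor `Ric(v,w) = tr (u ↦ R(u,v)w)`; tangent vectors at `x` are extended to vector
fields that are smooth near `x`, and the trace is taken in a basis of the tangent space. -/
def ricci (cov : CovariantDerivative I E (fun x : M ↦ TangentSpace I x)) (x : M)
    (v w : TangentSpace I x) : ℝ :=
  letI B : Module.Basis (Fin (Module.finrank ℝ E)) ℝ (TangentSpace I x) := Module.finBasis ℝ E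
  ∑ i, B.repr (curvature cov (extend E (B i)) (extend E v) (extend E w) x) i

lemma metric_bijective (g : ContMDiffRiemannianMetric I ∞ E (fun x : M ↦ TangentSpace I x))
    (x : M) : Function.Bijective (g.inner x) := by
  have hinj : Function.Injective (g.inner x).toLinearMap := by
    rw [← LinearMap.ker_eq_bot, LinearMap.ker_eq_bot']
    intro v hv
    by_contra hne
    have h1 := g.pos x v hne
    have h2 : g.inner x v = 0 := hv
    rw [h2] at h1
    exact lt_irrefl _ h1
  have hfr : Module.finrank ℝ E = Module.finrank ℝ (E →L[ℝ] ℝ) := by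
    rw [← (LinearMap.toContinuousLinearMap (𝕜 := ℝ) (E := E) (F' := ℝ)).finrank_eq]
    exact Subspace.dual_finrank_eq.symm
  exact ⟨hinj, (LinearMap.injective_iff_surjective_of_finrank_eq_finrank
    (V := E) (V₂ := E →L[ℝ] ℝ) (f := (g.inner x).toLinearMap) hfr).1 hinj⟩

/-- The gradient `∇f`, i.e. the vector field with `g(∇f, ·) = df`. -/
def grad (g : ContMDiffRiemannianMetric I ∞ E (fun x : M ↦ TangentSpace I x)) (f : M → ℝ)
    (x : M) : TangentSpace I x :=
  (metric_bijective g x).surjective (d% f x) |>.choose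

lemma inner_grad (g : ContMDiffRiemannianMetric I ∞ E (fun x : M ↦ TangentSpace I x))
    (f : M → ℝ) (x : M) (v : TangentSpace I x) : g.inner x (grad g f x) v = d% f x v := by
  rw [grad, ((metric_bijective g x).surjective (d% f x)).choose_spec]

/-- The Hessian `∇df(v,w) = g(∇_v ∇f, w)`. -/
def hess (g : ContMDiffRiemannianMetric I ∞ E (fun x : M ↦ TangentSpace I x))
    (cov : CovariantDerivative I E (fun x : M ↦ TangentSpace I x)) (f : M → ℝ) (x : M)
    (v w : TangentSpace I x) : ℝ :=
  g.inner x (cov (grad g f) x v) w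

/-- `(g,J)` is a Kähler structure on the open set `U`: `J` is a smooth, `g`-orthogonal almost
complex structure there which is parallel for the Levi-Civita connection `cov` of `g`. -/
structure IsKahlerOn (g : ContMDiffRiemannianMetric I ∞ E (fun x : M ↦ TangentSpace I x))
    (cov : CovariantDerivative I E (fun x : M ↦ TangentSpace I x))
    (J : Π x : M, TangentSpace I x →L[ℝ] TangentSpace I x) (U : Set M) : Prop where
  sq : ∀ x ∈ U, ∀ v, J x (J x v) = -v
  orthogonal : ∀ x ∈ U, ∀ v w, g.inner x (J x v) (J x w) = g.inner x v w
  smooth : ∀ x ∈ U, ∀ V : Π x : M, TangentSpace I x,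
    CMDiffAt ∞ (T% V) x → CMDiffAt ∞ (T% (fun y ↦ J y (V y))) x
  parallel : ∀ x ∈ U, ∀ V : Π x : M, TangentSpace I x, CMDiffAt ∞ (T% V) x →
    ∀ v, cov (fun y ↦ J y (V y)) x v = J x (cov V x v)

/-- The Kähler form `ω(v,w) = g(Jv,w)`. -/
def kahlerForm (g : ContMDiffRiemannianMetric I ∞ E (fun x : M ↦ TangentSpace I x))
    (J : Π x : M, TangentSpace I x →L[ℝ] TangentSpace I x) (x : M)
    (v w : TangentSpace I x) : ℝ :=
  g.inner x (J x v) w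

/-- The Ricci form `ρ(v,w) = Ric(Jv,w)`. -/
def ricciForm (cov : CovariantDerivative I E (fun x : M ↦ TangentSpace I x))
    (J : Π x : M, TangentSpace I x →L[ℝ] TangentSpace I x) (x : M)
    (v w : TangentSpace I x) : ℝ :=
  ricci cov x (J x v) w

/-- `(g,f)` is a gradient Kähler-Ricci skew-soliton on `U` with soliton constant `lam`: `g` is
Kähler and `ρ(v,w) + (∇df(Jv,w) - ∇df(Jw,v)) / 2 = lam * ω(v,w)`. -/
structure IsSkewSolitonOn (g : ContMDiffRiemannianMetric I ∞ E (fun x : M ↦ TangentSpace I x))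
    (cov : CovariantDerivative I E (fun x : M ↦ TangentSpace I x))
    (J : Π x : M, TangentSpace I x →L[ℝ] TangentSpace I x) (f : M → ℝ) (lam : ℝ)
    (U : Set M) : Prop where
  kahler : IsKahlerOn g cov J U
  smooth : CMDiff[U] ∞ f
  eqn : ∀ x ∈ U, ∀ v w : TangentSpace I x,
    ricciForm cov J x v w + 1 / 2 * (hess g cov f x (J x v) w - hess g cov f x (J x w) v)
      = lam * kahlerForm g J x v w

/-- `g` is a gradient Kähler-Ricci soliton on `U` with soliton potential `f` and soliton constant
`lam`: `g` is Kähler, `X = ∇f` is holomorphic (`L_X J = 0`), and `ρ + L_X ω / 2 = lam * ω`. The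
Lie derivatives are written out on vector fields:
`(L_X J) V = [X, J V] - J [X, V]` and
`(L_X ω)(V, W) = X (ω(V, W)) - ω([X, V], W) - ω(V, [X, W])`. -/
structure IsKahlerRicciSolitonOn
    (g : ContMDiffRiemannianMetric I ∞ E (fun x : M ↦ TangentSpace I x))
    (cov : CovariantDerivative I E (fun x : M ↦ TangentSpace I x))
    (J : Π x : M, TangentSpace I x →L[ℝ] TangentSpace I x) (f : M → ℝ) (lam : ℝ)
    (U : Set M) : Prop where
  kahler : IsKahlerOn g cov J U
  smooth : CMDiff[U] ∞ f
  holomorphic : ∀ x ∈ U, ∀ V : Π x : M, TangentSpace I x, CMDiffAt ∞ (T% V) x →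
    mlieBracket I (grad g f) (fun y ↦ J y (V y)) x = J x (mlieBracket I (grad g f) V x)
  eqn : ∀ x ∈ U, ∀ V W : Π x : M, TangentSpace I x,
    CMDiffAt ∞ (T% V) x → CMDiffAt ∞ (T% W) x →
      ricciForm cov J x (V x) (W x)
        + 1 / 2 * (d% (fun y ↦ kahlerForm g J y (V y) (W y)) x (grad g f x)
          - kahlerForm g J x (mlieBracket I (grad g f) V x) (W x)
          - kahlerForm g J x (V x) (mlieBracket I (grad g f) W x))
      = lam * kahlerForm g J x (V x) (W x)

end Geometry

section CohomogeneityOne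

/-- The product `∏ a_i b_i`. -/
def prodAB {n : ℕ} (a b : Fin n → ℝ → ℝ) (s : ℝ) : ℝ := ∏ i, a i s * b i s

/-- `α = (∏ a_i b_i) c`. -/
def alpha {n : ℕ} (a b : Fin n → ℝ → ℝ) (c : ℝ → ℝ) (s : ℝ) : ℝ := prodAB a b s * c s

variable {E : Type*} [NormedAddCommGroup E] [NormedSpace ℝ E] [FiniteDimensional ℝ E]
  {H : Type*} [TopologicalSpace H] {I : ModelWithCorners ℝ E H}
  {M : Type*} [TopologicalSpace M] [ChartedSpace H M] [IsManifold I ∞ M]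
  {E' : Type*} [NormedAddCommGroup E'] [NormedSpace ℝ E']
  {H' : Type*} [TopologicalSpace H'] {I' : ModelWithCorners ℝ E' H'}

/-- `(M,g)` of dimension `2n+2` is a cohomogeneity one manifold under a proper, smooth, isometric
action of a Lie group `G` of dimension `2n+1`, with a frame `∂_t = T, Z, X_i, Y_i` given on an open
set `U` of points lying on principal orbits.

* `t : U → S` is a smooth function onto an open interval, with `dt(T) = 1`, whose level sets are
  locally the `G`-orbits.
* `Z, X_i, Y_i` are tangent to the orbits, and the frame is (locally) `G`-invariant.
* The only nonzero Lie brackets are (up to antisymmetry)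
  `[X_i,Y_i] = -Γ_ii^z Z`, `[Y_i,Z] = -Γ_iz^i X_i`, `[Z,X_i] = -Γ_zi^i Y_i`
  for constants `Γz i = Γ_ii^z`, `Γx i = Γ_iz^i`, `Γy i = Γ_zi^i`.
* The metric is `g = (∏ a_i b_i)² c² dt² + c² ζ² + ∑ (a_i² σ_i² + b_i² ρ_i²)` for positive smooth
  functions `a_i, b_i, c` of `t`, where `dt, ζ, σ_i, ρ_i` is the dual coframe; that is, the frame is
  orthogonal, with the displayed squared lengths.
* `J T = (∏ a_i b_i) Z`, `J X_i = (a_i / b_i) Y_i`. -/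
structure IsDiagonalCohomOne (n : ℕ)
    (g : ContMDiffRiemannianMetric I ∞ E (fun x : M ↦ TangentSpace I x))
    (I' : ModelWithCorners ℝ E' H')
    (G : Type*) [TopologicalSpace G] [ChartedSpace H' G] [Group G] [MulAction G M]
    (U : Set M) (S : Set ℝ) (t : M → ℝ)
    (T Z : Π x : M, TangentSpace I x) (X Y : Fin n → Π x : M, TangentSpace I x)
    (Γz Γx Γy : Fin n → ℝ) (a b : Fin n → ℝ → ℝ) (c : ℝ → ℝ)
    (J : Π x : M, TangentSpace I x →L[ℝ] TangentSpace I x) : Prop where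
  dim_M : Module.finrank ℝ E = 2 * n + 2
  dim_G : Module.finrank ℝ E' = 2 * n + 1
  lieGroup : LieGroup I' ∞ G
  smooth_action : ContMDiffSMul I' I ∞ G M
  proper_action : ProperSMul G M
  isometric : ∀ (q : G) (x : M) (v w : TangentSpace I x),
    g.inner (q • x) (mfderiv I I (fun y : M ↦ q • y) x v) (mfderiv I I (fun y : M ↦ q • y) x w)
      = g.inner x v w
  isOpen_U : IsOpen U
  isOpen_S : IsOpen S
  interval_S : S.OrdConnected
  nonempty_S : S.Nonempty
  t_smooth : CMDiff[U] ∞ t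
  t_image : t '' U = S
  orbit_subset_level : ∀ x ∈ U, ∀ᶠ q in 𝓝 (1 : G), t (q • x) = t x
  level_subset_orbit : ∀ x ∈ U, ∀ᶠ y in 𝓝 x, t y = t x → y ∈ MulAction.orbit G x
  T_smooth : CMDiff[U] ∞ (T% T)
  Z_smooth : CMDiff[U] ∞ (T% Z)
  X_smooth : ∀ i, CMDiff[U] ∞ (T% (X i))
  Y_smooth : ∀ i, CMDiff[U] ∞ (T% (Y i))
  T_invariant : ∀ x ∈ U, ∀ᶠ q in 𝓝 (1 : G), mfderiv I I (fun y : M ↦ q • y) x (T x) = T (q • x)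
  Z_invariant : ∀ x ∈ U, ∀ᶠ q in 𝓝 (1 : G), mfderiv I I (fun y : M ↦ q • y) x (Z x) = Z (q • x)
  X_invariant : ∀ i, ∀ x ∈ U, ∀ᶠ q in 𝓝 (1 : G),
    mfderiv I I (fun y : M ↦ q • y) x (X i x) = X i (q • x)
  Y_invariant : ∀ i, ∀ x ∈ U, ∀ᶠ q in 𝓝 (1 : G),
    mfderiv I I (fun y : M ↦ q • y) x (Y i x) = Y i (q • x)
  dt_T : ∀ x ∈ U, d% t x (T x) = 1
  dt_Z : ∀ x ∈ U, d% t x (Z x) = 0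
  dt_X : ∀ i, ∀ x ∈ U, d% t x (X i x) = 0
  dt_Y : ∀ i, ∀ x ∈ U, d% t x (Y i x) = 0
  lie_T_Z : ∀ x ∈ U, mlieBracket I T Z x = 0
  lie_T_X : ∀ i, ∀ x ∈ U, mlieBracket I T (X i) x = 0
  lie_T_Y : ∀ i, ∀ x ∈ U, mlieBracket I T (Y i) x = 0
  lie_X_Y : ∀ i, ∀ x ∈ U, mlieBracket I (X i) (Y i) x = -(Γz i • Z x)
  lie_Y_Z : ∀ i, ∀ x ∈ U, mlieBracket I (Y i) Z x = -(Γx i • X i x)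
  lie_Z_X : ∀ i, ∀ x ∈ U, mlieBracket I Z (X i) x = -(Γy i • Y i x)
  lie_X_X : ∀ i j, i ≠ j → ∀ x ∈ U, mlieBracket I (X i) (X j) x = 0
  lie_X_Y_ne : ∀ i j, i ≠ j → ∀ x ∈ U, mlieBracket I (X i) (Y j) x = 0
  lie_Y_Y : ∀ i j, i ≠ j → ∀ x ∈ U, mlieBracket I (Y i) (Y j) x = 0
  a_smooth : ∀ i, ContDiffOn ℝ ∞ (a i) S
  b_smooth : ∀ i, ContDiffOn ℝ ∞ (b i) S
  c_smooth : ContDiffOn ℝ ∞ c S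
  a_pos : ∀ i, ∀ s ∈ S, 0 < a i s
  b_pos : ∀ i, ∀ s ∈ S, 0 < b i s
  c_pos : ∀ s ∈ S, 0 < c s
  g_T_T : ∀ x ∈ U, g.inner x (T x) (T x) = prodAB a b (t x) ^ 2 * c (t x) ^ 2
  g_Z_Z : ∀ x ∈ U, g.inner x (Z x) (Z x) = c (t x) ^ 2
  g_X_X : ∀ i, ∀ x ∈ U, g.inner x (X i x) (X i x) = a i (t x) ^ 2
  g_Y_Y : ∀ i, ∀ x ∈ U, g.inner x (Y i x) (Y i x) = b i (t x) ^ 2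
  g_T_Z : ∀ x ∈ U, g.inner x (T x) (Z x) = 0
  g_T_X : ∀ i, ∀ x ∈ U, g.inner x (T x) (X i x) = 0
  g_T_Y : ∀ i, ∀ x ∈ U, g.inner x (T x) (Y i x) = 0
  g_Z_X : ∀ i, ∀ x ∈ U, g.inner x (Z x) (X i x) = 0
  g_Z_Y : ∀ i, ∀ x ∈ U, g.inner x (Z x) (Y i x) = 0
  g_X_Y : ∀ i j, ∀ x ∈ U, g.inner x (X i x) (Y j x) = 0
  g_X_X_ne : ∀ i j, i ≠ j → ∀ x ∈ U, g.inner x (X i x) (X j x) = 0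
  g_Y_Y_ne : ∀ i j, i ≠ j → ∀ x ∈ U, g.inner x (Y i x) (Y j x) = 0
  J_T : ∀ x ∈ U, J x (T x) = prodAB a b (t x) • Z x
  J_Z : ∀ x ∈ U, J x (Z x) = -((prodAB a b (t x))⁻¹ • T x)
  J_X : ∀ i, ∀ x ∈ U, J x (X i x) = (a i (t x) / b i (t x)) • Y i x
  J_Y : ∀ i, ∀ x ∈ U, J x (Y i x) = -((b i (t x) / a i (t x)) • X i x)

end CohomogeneityOne

end KRSkew

end

noncomputable section

set_option linter.unusedSectionVars false

namespace KRSkew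

/-! ### Local orthonormal frames and smooth vector fields. -/

section Frames

variable {E : Type*} [NormedAddCommGroup E] [NormedSpace ℝ E] [FiniteDimensional ℝ E]
  {H : Type*} [TopologicalSpace H] {I : ModelWithCorners ℝ E H}
  {M : Type*} [TopologicalSpace M] [ChartedSpace H M] [IsManifold I ∞ M]
  {g : ContMDiffRiemannianMetric I ∞ E (fun x : M ↦ TangentSpace I x)}
  {cov : CovariantDerivative I E (fun x : M ↦ TangentSpace I x)}
  {V V' W W' P : Π x : M, TangentSpace I x} {f : M → ℝ} {x : M}
  {ι : Type*} [Fintype ι] [DecidableEq ι] {e : ι → Π x : M, TangentSpace I x} {U : Set M}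

/-! The skew-soliton equation is the exactness statement `dη = λω` for one explicit 1-form. Take an
orthonormal frame `e_a` in which the matrix of `J` is constant, and let `θ(v) = ∑ g(∇_v e_a, J e_a)`
(`connForm`). If `J` is parallel, the Ricci form is `-dθ/2` (`ricciForm_eq_connForm`): the curvature
commutes with `J`, the Bianchi identity turns the Ricci trace into a trace of `R(v,w)` against `J`,
and the quadratic terms in the connection cancel. Likewise the skew part of the Hessian of `f`
composed with `J` is `d(g(J∇f, ·))/2` (`hess_skew`, where the factor `1/2` is moved to the soliton
equation). So the equation reads `dη = λω` with `η = -θ/2 + g(J∇f, ·)/2`.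

For the diagonal metric everything depends on `t` alone. The Koszul formula gives all connection
coefficients (`connNum`), and the two equations for the logarithmic derivatives of `a_i`, `b_i` are
solved for `a_i'` and `b_i'`; these values make `J` parallel (`connNum_star`, `isKahlerOn`). Both
parts of `η` are multiples of `ζ`, and the equation for `c'` says precisely that `η = φ(t) ζ` with
`φ = (λ/Γ_ii^z) a_i b_i`. Then `dη = φ' dt ∧ ζ + φ dζ`: the first term matches `λω` on the plane of
`∂_t, Z` by the equation for `(a_i b_i)'`, the second on each plane of `X_i, Y_i` because `Γ_ii^z /
(a_i b_i)` does not depend on `i`.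

If also `Γ_iz^i a_i² = Γ_zi^i b_i²`, then `a_i` and `b_i` have equal logarithmic derivatives, hence
constant ratio, and substitution gives the reduced system. If moreover `f' = kαc`, then `∇f` is `kc`
times the unit normal, so `J∇f = kZ`. Its covariant derivative is diagonal in the frame with equal
eigenvalues on each `J`-plane (`cov_grad_J`), so `∇f` is holomorphic, and a skew-soliton with
holomorphic gradient is a soliton. -/

lemma mdiffAt_of_smooth (hV : CMDiffAt ∞ (T% V) x) : MDiffAt (T% V) x :=
  hV.mdifferentiableAt (by simp)

lemma eventually_mdiffAt_of_smooth (hV : CMDiffAt ∞ (T% V) x) :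
    ∀ᶠ y in 𝓝 x, MDiffAt (T% V) y := by
  have h : CMDiffAt 1 (T% V) x := hV.of_le (by norm_cast)
  filter_upwards [(contMDiffAt_iff_contMDiffAt_nhds (by simp)).1 h] with y hy
    using hy.mdifferentiableAt (by simp)

lemma contMDiffAt_inner (hV : CMDiffAt ∞ (T% V) x) (hW : CMDiffAt ∞ (T% W) x) :
    CMDiffAt ∞ (fun y ↦ g.inner y (V y) (W y)) x := by
  have := (g.contMDiff x).clm_bundle_apply₂ (F₁ := E) (F₂ := E) hV hW
  simp only [contMDiffAt_totalSpace] at this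
  exact this.2

/-- Smooth vector fields which are `g`-orthonormal on the open set `U` and as many as the dimension
of the manifold. -/
structure IsOrthonormalFrameOn
    (g : ContMDiffRiemannianMetric I ∞ E (fun x : M ↦ TangentSpace I x))
    (e : ι → Π x : M, TangentSpace I x) (U : Set M) : Prop where
  isOpen : IsOpen U
  smooth : ∀ a, CMDiff[U] ∞ (T% (e a))
  inner : ∀ x ∈ U, ∀ a b, g.inner x (e a x) (e b x) = if a = b then 1 else 0
  card : Fintype.card ι = Module.finrank ℝ E

namespace IsOrthonormalFrameOn

lemma smoothAt (he : IsOrthonormalFrameOn g e U) (hx : x ∈ U) (a : ι) : CMDiffAt ∞ (T% (e a)) x :=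
  (he.smooth a).contMDiffAt (he.isOpen.mem_nhds hx)

lemma linearIndependent (he : IsOrthonormalFrameOn g e U) (hx : x ∈ U) :
    LinearIndependent ℝ (fun a ↦ e a x) := by
  rw [Fintype.linearIndependent_iff]
  intro c hc a
  have h : g.inner x (∑ b, c b • e b x) (e a x) = 0 := by rw [hc]; simp
  simpa [he.inner x hx] using h

/-- The basis of the tangent space given by the frame. -/
def basis (he : IsOrthonormalFrameOn g e U) (hx : x ∈ U) :
    Module.Basis ι ℝ (TangentSpace I x) :=
  Module.Basis.mk (he.linearIndependent hx) (by
    have : FiniteDimensional ℝ (TangentSpace I x) := inferInstanceAs (FiniteDimensional ℝ E)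
    exact ((he.linearIndependent hx).span_eq_top_of_card_eq_finrank' he.card).ge)

lemma basis_apply (he : IsOrthonormalFrameOn g e U) (hx : x ∈ U) (a : ι) :
    he.basis hx a = e a x := by simp [basis]

lemma basis_repr (he : IsOrthonormalFrameOn g e U) (hx : x ∈ U) (v : TangentSpace I x) (a : ι) :
    (he.basis hx).repr v a = g.inner x v (e a x) := by
  conv_rhs => rw [← (he.basis hx).sum_repr v]
  simp [basis_apply, he.inner x hx]

lemma sum_inner_smul (he : IsOrthonormalFrameOn g e U) (hx : x ∈ U) (v : TangentSpace I x) :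
    ∑ a, g.inner x v (e a x) • e a x = v := by
  conv_rhs => rw [← (he.basis hx).sum_repr v]
  simp [basis_apply, basis_repr]

lemma sum_inner_mul_inner (he : IsOrthonormalFrameOn g e U) (hx : x ∈ U)
    (v w : TangentSpace I x) :
    ∑ a, g.inner x v (e a x) * g.inner x (e a x) w = g.inner x v w := by
  conv_rhs => rw [← he.sum_inner_smul hx v]
  simp

lemma ext_inner (he : IsOrthonormalFrameOn g e U) (hx : x ∈ U) {v w : TangentSpace I x}
    (h : ∀ a, g.inner x v (e a x) = g.inner x w (e a x)) : v = w := by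
  rw [← he.sum_inner_smul hx v, ← he.sum_inner_smul hx w]
  simp [h]

end IsOrthonormalFrameOn

lemma mdiffAt_fun_of_smooth (hf : CMDiffAt ∞ f x) : MDiffAt f x :=
  hf.mdifferentiableAt (by simp)

lemma contMDiffAt_lieBracket (hV : CMDiffAt ∞ (T% V) x) (hW : CMDiffAt ∞ (T% W) x) :
    CMDiffAt ∞ (T% (mlieBracket I V W)) x := by
  have : IsManifold I (((⊤ : ℕ∞) : WithTop ℕ∞) + 1) M := inferInstanceAs (IsManifold I ∞ M)
  have : IsManifold I (minSmoothness ℝ 2) M := by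
    rw [minSmoothness_of_isRCLikeNormedField]
    infer_instance
  exact ContMDiffAt.mlieBracket_vectorField (n := ⊤) (m := ⊤) hV hW (by simp)

lemma mvfderiv_congr {f₁ f₂ : M → ℝ} (h : ∀ᶠ y in 𝓝 x, f₁ y = f₂ y) : d% f₁ x = d% f₂ x := by
  have := Filter.EventuallyEq.mfderiv_eq (I := I) (I' := 𝓘(ℝ, ℝ)) h
  simp only [mvfderiv]
  rw [this]
  rfl

/-- An operation on vector fields is tensorial at `x` with respect to smooth sections and smooth
functions. -/
structure SmoothTensorialAt {A : Type*} [AddCommGroup A] [Module ℝ A]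
    (Φ : (Π x : M, TangentSpace I x) → A) (x : M) : Prop where
  add : ∀ {V W : Π x : M, TangentSpace I x}, CMDiffAt ∞ (T% V) x → CMDiffAt ∞ (T% W) x →
    Φ (V + W) = Φ V + Φ W
  smul : ∀ {f : M → ℝ} {V : Π x : M, TangentSpace I x}, CMDiffAt ∞ f x → CMDiffAt ∞ (T% V) x →
    Φ (f • V) = f x • Φ V

/-! ### Tensoriality and dependence on the value at a point. -/

namespace SmoothTensorialAt

variable {A : Type*} [AddCommGroup A] [Module ℝ A] {Φ : (Π x : M, TangentSpace I x) → A}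

/-- No bump function is needed: the indicator `ψ` of the set where the two fields agree is `1` near
`x`, hence smooth at `x`, and `ψ • V = ψ • W` holds globally. -/
lemma congr (hΦ : SmoothTensorialAt Φ x) (hV : CMDiffAt ∞ (T% V) x) (hW : CMDiffAt ∞ (T% W) x)
    (h : ∀ᶠ y in 𝓝 x, V y = W y) : Φ V = Φ W := by
  classical
  let ψ (y : M) : ℝ := if V y = W y then 1 else 0
  have hψx : ψ x = 1 := by simp [ψ, h.self_of_nhds]
  have hψ : CMDiffAt ∞ ψ x :=
    (contMDiffAt_const (c := (1 : ℝ))).congr_of_eventuallyEq (h.mono fun y hy ↦ by simp [ψ, hy])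
  have heq : ψ • V = ψ • W := by
    funext y
    simp only [Pi.smul_apply', ψ]
    split_ifs with hy <;> simp [hy]
  have h1 := hΦ.smul hψ hV
  rw [heq, hΦ.smul hψ hW, hψx, one_smul, one_smul] at h1
  exact h1.symm

lemma sum (hΦ : SmoothTensorialAt Φ x) {κ : Type*} (s : Finset κ)
    (F : κ → Π x : M, TangentSpace I x) (hF : ∀ a ∈ s, CMDiffAt ∞ (T% (F a)) x) :
    Φ (fun y ↦ ∑ a ∈ s, F a y) = ∑ a ∈ s, Φ (F a) := by
  classical
  induction s using Finset.induction_on with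
  | empty =>
    have h0 : CMDiffAt ∞ (T% (0 : Π x : M, TangentSpace I x)) x :=
      (contMDiff_zeroSection ℝ (fun x : M ↦ TangentSpace I x)).contMDiffAt
    have := hΦ.smul (f := fun _ ↦ (0 : ℝ)) contMDiffAt_const h0
    simpa using! this
  | insert b s hb ih =>
    simp only [Finset.mem_insert, forall_eq_or_imp] at hF
    simp only [Finset.sum_insert hb, ← ih hF.2]
    exact hΦ.add hF.1 (.sum_section hF.2)

/-- Expanding the field in the frame near `x` shows that the result depends only on the value of the
field at `x`. -/
lemma eq_sum (hΦ : SmoothTensorialAt Φ x) (he : IsOrthonormalFrameOn g e U) (hx : x ∈ U)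
    (hV : CMDiffAt ∞ (T% V) x) : Φ V = ∑ a, g.inner x (V x) (e a x) • Φ (e a) := by
  have hs (a : ι) : CMDiffAt ∞ (fun y ↦ g.inner y (V y) (e a y)) x :=
    contMDiffAt_inner hV (he.smoothAt hx a)
  have hs' (a : ι) : CMDiffAt ∞ (T% ((fun y ↦ g.inner y (V y) (e a y)) • e a)) x :=
    (hs a).smul_section (he.smoothAt hx a)
  have hsum : CMDiffAt ∞ (T% (fun y ↦ ∑ a, ((fun y ↦ g.inner y (V y) (e a y)) • e a) y)) x :=
    .sum_section fun a _ ↦ hs' a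
  rw [hΦ.congr hV hsum, hΦ.sum _ _ fun a _ ↦ hs' a]
  · exact Finset.sum_congr rfl fun a _ ↦ hΦ.smul (hs a) (he.smoothAt hx a)
  · filter_upwards [he.isOpen.mem_nhds hx] with y hy
    exact (he.sum_inner_smul hy (V y)).symm

end SmoothTensorialAt

lemma contMDiffAt_of_inner (he : IsOrthonormalFrameOn g e U) (hx : x ∈ U)
    (h : ∀ a, CMDiffAt ∞ (fun y ↦ g.inner y (V y) (e a y)) x) : CMDiffAt ∞ (T% V) x := by
  have hsum : CMDiffAt ∞ (T% (fun y ↦ ∑ a, ((fun y ↦ g.inner y (V y) (e a y)) • e a) y)) x :=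
    .sum_section fun a _ ↦ (h a).smul_section (he.smoothAt hx a)
  refine hsum.congr_of_eventuallyEq ?_
  filter_upwards [he.isOpen.mem_nhds hx] with y hy
  simp [he.sum_inner_smul hy (V y)]

lemma eventually_mdiffAt_fun (hf : CMDiffAt ∞ f x) : ∀ᶠ y in 𝓝 x, MDiffAt f y := by
  have h : CMDiffAt 1 f x := hf.of_le (by norm_cast)
  filter_upwards [(contMDiffAt_iff_contMDiffAt_nhds (by simp)).1 h] with y hy
    using hy.mdifferentiableAt (by simp)

/-- The identity `[V, f e] - f [V, e] = df(V) e`, paired with a unit field `e`, expresses the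
directional derivative through brackets, which are known to be smooth. -/
lemma contMDiffAt_dir [Nonempty ι] (he : IsOrthonormalFrameOn g e U) (hx : x ∈ U)
    (hf : CMDiffAt ∞ f x) (hV : CMDiffAt ∞ (T% V) x) :
    CMDiffAt ∞ (fun y ↦ d% f y (V y)) x := by
  let a : ι := Classical.arbitrary ι
  have hea := he.smoothAt hx a
  have h1 : CMDiffAt ∞ (fun y ↦ g.inner y (mlieBracket I V (f • e a) y) (e a y)
      - f y * g.inner y (mlieBracket I V (e a) y) (e a y)) x :=
    (contMDiffAt_inner (contMDiffAt_lieBracket hV (hf.smul_section hea)) hea).sub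
      (hf.mul (contMDiffAt_inner (contMDiffAt_lieBracket hV hea) hea))
  refine h1.congr_of_eventuallyEq ?_
  filter_upwards [he.isOpen.mem_nhds hx, eventually_mdiffAt_fun hf,
    eventually_mdiffAt_of_smooth hea] with y hy hfy hey
  rw [mlieBracket_smul_right hfy hey]
  simp [he.inner y hy]

/-! ### The Koszul formula and smoothness of covariant derivatives. -/

namespace IsLeviCivita

lemma bracket_eq (hcov : IsLeviCivita g cov) (hV : MDiffAt (T% V) x) (hW : MDiffAt (T% W) x) :
    mlieBracket I V W x = cov W x (V x) - cov V x (W x) :=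
  ((CovariantDerivative.torsion_eq_zero_iff cov).1 hcov.torsion_eq_zero hV hW).symm

/-- The Koszul formula. -/
lemma koszul (hcov : IsLeviCivita g cov) (hV : MDiffAt (T% V) x) (hW : MDiffAt (T% W) x)
    (hP : MDiffAt (T% P) x) :
    2 * g.inner x (cov W x (V x)) (P x) =
      d% (fun y ↦ g.inner y (W y) (P y)) x (V x) + d% (fun y ↦ g.inner y (V y) (P y)) x (W x)
      - d% (fun y ↦ g.inner y (V y) (W y)) x (P x)
      + g.inner x (mlieBracket I V W x) (P x) - g.inner x (mlieBracket I V P x) (W x)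
      - g.inner x (mlieBracket I W P x) (V x) := by
  rw [hcov.metric x _ _ _ hW hP, hcov.metric x _ _ _ hV hP, hcov.metric x _ _ _ hV hW,
    hcov.bracket_eq hV hW, hcov.bracket_eq hV hP, hcov.bracket_eq hW hP]
  simp only [map_sub, sub_apply]
  rw [g.symm x (V x), g.symm x (V x), g.symm x (W x)]
  ring

/-- Regularity of `cov` is inherited from `g`: by the Koszul formula the frame components of `∇_V W`
are smooth. -/
lemma contMDiffAt_cov [Nonempty ι] (hcov : IsLeviCivita g cov) (he : IsOrthonormalFrameOn g e U)
    (hx : x ∈ U) (hV : CMDiffAt ∞ (T% V) x) (hW : CMDiffAt ∞ (T% W) x) :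
    CMDiffAt ∞ (T% (fun y ↦ cov W y (V y))) x := by
  refine contMDiffAt_of_inner he hx fun a ↦ ?_
  have hP := he.smoothAt hx a
  have h : CMDiffAt ∞ (fun y ↦ (1 / 2 : ℝ) * (
      d% (fun y ↦ g.inner y (W y) (e a y)) y (V y) + d% (fun y ↦ g.inner y (V y) (e a y)) y (W y)
      - d% (fun y ↦ g.inner y (V y) (W y)) y (e a y)
      + g.inner y (mlieBracket I V W y) (e a y) - g.inner y (mlieBracket I V (e a) y) (W y)
      - g.inner y (mlieBracket I W (e a) y) (V y))) x :=
    contMDiffAt_const.mul ((((((contMDiffAt_dir he hx (contMDiffAt_inner hW hP) hV).add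
      (contMDiffAt_dir he hx (contMDiffAt_inner hV hP) hW)).sub
      (contMDiffAt_dir he hx (contMDiffAt_inner hV hW) hP)).add
      (contMDiffAt_inner (contMDiffAt_lieBracket hV hW) hP)).sub
      (contMDiffAt_inner (contMDiffAt_lieBracket hV hP) hW)).sub
      (contMDiffAt_inner (contMDiffAt_lieBracket hW hP) hV))
  refine h.congr_of_eventuallyEq ?_
  filter_upwards [eventually_mdiffAt_of_smooth hV, eventually_mdiffAt_of_smooth hW,
    eventually_mdiffAt_of_smooth hP] with y h1 h2 h3
  rw [← hcov.koszul h1 h2 h3]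
  ring

end IsLeviCivita

lemma cov_congr (hV : MDiffAt (T% V) x) (hW : MDiffAt (T% W) x) (h : ∀ᶠ y in 𝓝 x, V y = W y) :
    cov V x = cov W x :=
  cov.isCovariantDerivativeOnUniv.congr_of_eventuallyEq hV hW Filter.univ_mem h

lemma cov_add (hV : MDiffAt (T% V) x) (hW : MDiffAt (T% W) x) :
    cov (V + W) x = cov V x + cov W x :=
  cov.isCovariantDerivativeOnUniv.add hV hW

lemma cov_smul (hf : MDiffAt f x) (hV : MDiffAt (T% V) x) (v : TangentSpace I x) :
    cov (f • V) x v = f x • cov V x v + d% f x v • V x := by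
  rw [cov.isCovariantDerivativeOnUniv.leibniz hV hf]
  simp

/-- The bracket of vector fields is the commutator of the derivations. -/
lemma dir_bracket [Nonempty ι] (he : IsOrthonormalFrameOn g e U) (hx : x ∈ U)
    (hf : CMDiffAt ∞ f x) (hV : CMDiffAt ∞ (T% V) x) (hW : CMDiffAt ∞ (T% W) x) :
    d% f x (mlieBracket I V W x) =
      d% (fun y ↦ d% f y (W y)) x (V x) - d% (fun y ↦ d% f y (V y)) x (W x) := by
  let a : ι := Classical.arbitrary ι
  have hea := he.smoothAt hx a
  have hfe := hf.smul_section hea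
  have hms {X : Π x : M, TangentSpace I x} (hX : CMDiffAt ∞ (T% X) x) :
      CMDiffAt (minSmoothness ℝ 2) (T% X) x := by
    rw [minSmoothness_of_isRCLikeNormedField]
    exact hX.of_le (by norm_cast)
  have hM3 : IsManifold I (minSmoothness ℝ 3) M := by
    rw [minSmoothness_of_isRCLikeNormedField]
    infer_instance
  have key {X Y : Π x : M, TangentSpace I x} (hX : CMDiffAt ∞ (T% X) x)
      (hY : CMDiffAt ∞ (T% Y) x) : mlieBracket I X (mlieBracket I Y (f • e a)) x =
      d% (fun y ↦ d% f y (Y y)) x (X x) • e a x + d% f x (Y x) • mlieBracket I X (e a) x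
      + (d% f x (X x) • mlieBracket I Y (e a) x
        + f x • mlieBracket I X (mlieBracket I Y (e a)) x) := by
    have h1 : mlieBracket I Y (f • e a) =ᶠ[𝓝 x]
        (fun y ↦ d% f y (Y y)) • e a + f • mlieBracket I Y (e a) := by
      filter_upwards [eventually_mdiffAt_fun hf, eventually_mdiffAt_of_smooth hea] with y h1 h2
      rw [mlieBracket_smul_right h1 h2]
      rfl
    have hd := contMDiffAt_dir he hx hf hY
    have hb := contMDiffAt_lieBracket hY hea
    rw [show mlieBracket I X (mlieBracket I Y (f • e a)) x = _ from
        (Filter.EventuallyEq.refl (𝓝 x) X).mlieBracket_vectorField_eq h1,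
      mlieBracket_add_right (mdiffAt_of_smooth (hd.smul_section hea))
        (mdiffAt_of_smooth (hf.smul_section hb)),
      mlieBracket_smul_right (mdiffAt_fun_of_smooth hd) (mdiffAt_of_smooth hea),
      mlieBracket_smul_right (mdiffAt_fun_of_smooth hf) (mdiffAt_of_smooth hb)]
  -- Jacobi for `V, W, f e` minus `f` times Jacobi for `V, W, e`: the first-order terms cancel, and
  -- the coefficient of the unit vector `e` is the claim.
  have h1 := leibniz_identity_mlieBracket_apply (hms hV) (hms hW) (hms hfe)
  have h2 := leibniz_identity_mlieBracket_apply (hms hV) (hms hW) (hms hea)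
  rw [key hV hW, key hW hV, mlieBracket_smul_right (mdiffAt_fun_of_smooth hf)
    (mdiffAt_of_smooth hea), h2] at h1
  have h3 := congrArg (fun v ↦ g.inner x v (e a x)) h1
  simp [he.inner x hx] at h3
  linarith

/-! ### Tensoriality and symmetries of the curvature. -/

namespace IsLeviCivita

variable [Nonempty ι]

lemma curvature_tensorial₁ (hcov : IsLeviCivita g cov) (he : IsOrthonormalFrameOn g e U)
    (hx : x ∈ U) (hP : CMDiffAt ∞ (T% P) x) :
    SmoothTensorialAt (fun V ↦ curvature cov V W P x) x where
  add {V V'} hV hV' := by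
    have h : (fun y ↦ cov P y ((V + V') y)) = (fun y ↦ cov P y (V y)) + fun y ↦ cov P y (V' y) := by
      funext y; simp
    simp only [curvature]
    rw [h, cov_add (mdiffAt_of_smooth (hcov.contMDiffAt_cov he hx hV hP))
      (mdiffAt_of_smooth (hcov.contMDiffAt_cov he hx hV' hP)),
      mlieBracket_add_left (mdiffAt_of_smooth hV) (mdiffAt_of_smooth hV')]
    simp only [Pi.add_apply, map_add, add_apply]
    abel
  smul {f V} hf hV := by
    have h : (fun y ↦ cov P y ((f • V) y)) = f • (fun y ↦ cov P y (V y)) := by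
      funext y; simp
    simp only [curvature]
    rw [h, cov_smul (mdiffAt_fun_of_smooth hf)
      (mdiffAt_of_smooth (hcov.contMDiffAt_cov he hx hV hP)),
      mlieBracket_smul_left (mdiffAt_fun_of_smooth hf) (mdiffAt_of_smooth hV)]
    simp only [Pi.smul_apply', map_add, map_smul]
    module

lemma curvature_swap (V W P : Π x : M, TangentSpace I x) (x : M) :
    curvature cov V W P x = -curvature cov W V P x := by
  simp only [curvature]
  rw [mlieBracket_swap_apply, map_neg]
  abel

lemma curvature_tensorial₂ (hcov : IsLeviCivita g cov) (he : IsOrthonormalFrameOn g e U)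
    (hx : x ∈ U) (hP : CMDiffAt ∞ (T% P) x) :
    SmoothTensorialAt (fun W ↦ curvature cov V W P x) x where
  add h1 h2 := by
    simp only [curvature_swap V, (hcov.curvature_tensorial₁ he hx hP).add h1 h2]
    abel
  smul h1 h2 := by
    simp only [curvature_swap V, (hcov.curvature_tensorial₁ he hx hP).smul h1 h2, smul_neg]

/-- The first derivatives of `f` cancel by symmetry in `V, W`; the second derivatives leave `[V,W]
f`, which the term `∇_[V,W]` removes. -/
lemma curvature_tensorial₃ (hcov : IsLeviCivita g cov) (he : IsOrthonormalFrameOn g e U)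
    (hx : x ∈ U) (hV : CMDiffAt ∞ (T% V) x) (hW : CMDiffAt ∞ (T% W) x) :
    SmoothTensorialAt (fun P ↦ curvature cov V W P x) x where
  add {P P'} hP hP' := by
    have key {X Y : Π x : M, TangentSpace I x} (hY : CMDiffAt ∞ (T% Y) x) :
        cov (fun y ↦ cov (P + P') y (Y y)) x (X x) =
          cov (fun y ↦ cov P y (Y y)) x (X x) + cov (fun y ↦ cov P' y (Y y)) x (X x) := by
      have h1 := hcov.contMDiffAt_cov he hx hY hP
      have h2 := hcov.contMDiffAt_cov he hx hY hP'
      rw [← add_apply, ← cov_add (mdiffAt_of_smooth h1)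
        (mdiffAt_of_smooth h2), cov_congr (mdiffAt_of_smooth
          (hcov.contMDiffAt_cov he hx hY (hP.add_section hP')))
          (mdiffAt_of_smooth (h1.add_section h2))]
      filter_upwards [eventually_mdiffAt_of_smooth hP, eventually_mdiffAt_of_smooth hP'] with y h3 h4
      rw [cov_add h3 h4]
      rfl
    simp only [curvature, key hV, key hW, cov_add (mdiffAt_of_smooth hP) (mdiffAt_of_smooth hP'),
      add_apply]
    abel
  smul {f P} hf hP := by
    have key {X Y : Π x : M, TangentSpace I x} (hY : CMDiffAt ∞ (T% Y) x) :
        cov (fun y ↦ cov (f • P) y (Y y)) x (X x) =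
          f x • cov (fun y ↦ cov P y (Y y)) x (X x) + d% f x (X x) • cov P x (Y x)
          + (d% f x (Y x) • cov P x (X x) + d% (fun y ↦ d% f y (Y y)) x (X x) • P x) := by
      have h1 := hcov.contMDiffAt_cov he hx hY hP
      have hd := contMDiffAt_dir he hx hf hY
      rw [← cov_smul (mdiffAt_fun_of_smooth hf) (mdiffAt_of_smooth h1),
        ← cov_smul (mdiffAt_fun_of_smooth hd) (mdiffAt_of_smooth hP), ← add_apply,
        ← cov_add (mdiffAt_of_smooth (hf.smul_section h1))
          (mdiffAt_of_smooth (hd.smul_section hP)),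
        cov_congr (mdiffAt_of_smooth (hcov.contMDiffAt_cov he hx hY (hf.smul_section hP)))
          (mdiffAt_of_smooth ((hf.smul_section h1).add_section (hd.smul_section hP)))]
      filter_upwards [eventually_mdiffAt_fun hf, eventually_mdiffAt_of_smooth hP] with y h3 h4
      rw [cov_smul h3 h4]
      rfl
    simp only [curvature, key hV, key hW, cov_smul (mdiffAt_fun_of_smooth hf)
      (mdiffAt_of_smooth hP), dir_bracket he hx hf hV hW]
    module

/-- This makes the extensions of tangent vectors in the definition of `ricci` immaterial, so that
the curvature may be computed with any convenient smooth fields. -/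
lemma curvature_congr (hcov : IsLeviCivita g cov) (he : IsOrthonormalFrameOn g e U)
    (hx : x ∈ U) {P' : Π x : M, TangentSpace I x}
    (hV : CMDiffAt ∞ (T% V) x) (hV' : CMDiffAt ∞ (T% V') x)
    (hW : CMDiffAt ∞ (T% W) x) (hW' : CMDiffAt ∞ (T% W') x)
    (hP : CMDiffAt ∞ (T% P) x) (hP' : CMDiffAt ∞ (T% P') x)
    (h1 : V x = V' x) (h2 : W x = W' x) (h3 : P x = P' x) :
    curvature cov V W P x = curvature cov V' W' P' x := by
  rw [(hcov.curvature_tensorial₁ he hx hP).eq_sum he hx hV, h1,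
    ← (hcov.curvature_tensorial₁ he hx hP).eq_sum he hx hV',
    (hcov.curvature_tensorial₂ he hx hP).eq_sum he hx hW, h2,
    ← (hcov.curvature_tensorial₂ he hx hP).eq_sum he hx hW',
    (hcov.curvature_tensorial₃ he hx hV' hW').eq_sum he hx hP, h3,
    ← (hcov.curvature_tensorial₃ he hx hV' hW').eq_sum he hx hP']

lemma dir_inner_eventually (hcov : IsLeviCivita g cov) (hV : CMDiffAt ∞ (T% V) x)
    (hW : CMDiffAt ∞ (T% W) x) (Y : Π x : M, TangentSpace I x) :
    ∀ᶠ y in 𝓝 x, d% (fun y ↦ g.inner y (V y) (W y)) y (Y y)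
      = g.inner y (cov V y (Y y)) (W y) + g.inner y (V y) (cov W y (Y y)) := by
  filter_upwards [eventually_mdiffAt_of_smooth hV, eventually_mdiffAt_of_smooth hW] with y h1 h2
  exact hcov.metric y _ _ _ h1 h2

/-- Apply `[V,W] = VW - WV` to the function `g(P,Q)` and expand both sides by metric compatibility;
the products of first derivatives are symmetric and drop out. -/
lemma inner_curvature_skew (hcov : IsLeviCivita g cov) (he : IsOrthonormalFrameOn g e U)
    (hx : x ∈ U) {Q : Π x : M, TangentSpace I x} (hV : CMDiffAt ∞ (T% V) x)
    (hW : CMDiffAt ∞ (T% W) x) (hP : CMDiffAt ∞ (T% P) x) (hQ : CMDiffAt ∞ (T% Q) x) :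
    g.inner x (curvature cov V W P x) (Q x) = -g.inner x (P x) (curvature cov V W Q x) := by
  have key {X Y : Π x : M, TangentSpace I x} (hY : CMDiffAt ∞ (T% Y) x) :
      d% (fun y ↦ d% (fun y ↦ g.inner y (P y) (Q y)) y (Y y)) x (X x) =
        g.inner x (cov (fun y ↦ cov P y (Y y)) x (X x)) (Q x)
        + g.inner x (cov P x (Y x)) (cov Q x (X x))
        + (g.inner x (cov P x (X x)) (cov Q x (Y x))
        + g.inner x (P x) (cov (fun y ↦ cov Q y (Y y)) x (X x))) := by
    have h1 := hcov.contMDiffAt_cov he hx hY hP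
    have h2 := hcov.contMDiffAt_cov he hx hY hQ
    rw [mvfderiv_congr (hcov.dir_inner_eventually hP hQ Y),
      mvfderiv_fun_add (mdiffAt_fun_of_smooth (contMDiffAt_inner h1 hQ))
        (mdiffAt_fun_of_smooth (contMDiffAt_inner hP h2)), add_apply,
      hcov.metric x _ _ _ (mdiffAt_of_smooth h1) (mdiffAt_of_smooth hQ),
      hcov.metric x _ _ _ (mdiffAt_of_smooth hP) (mdiffAt_of_smooth h2)]
  have h := dir_bracket he hx (contMDiffAt_inner (g := g) hP hQ) hV hW
  rw [key hV, key hW, hcov.metric x _ _ _ (mdiffAt_of_smooth hP) (mdiffAt_of_smooth hQ)] at h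
  simp only [curvature, map_sub, sub_apply]
  linarith

/-- For a torsion-free connection this is the Jacobi identity with every bracket written as a
difference of covariant derivatives. -/
lemma curvature_bianchi (hcov : IsLeviCivita g cov) (he : IsOrthonormalFrameOn g e U)
    (hx : x ∈ U) (hV : CMDiffAt ∞ (T% V) x) (hW : CMDiffAt ∞ (T% W) x)
    (hP : CMDiffAt ∞ (T% P) x) :
    curvature cov V W P x + curvature cov W P V x + curvature cov P V W x = 0 := by
  have hms {X : Π x : M, TangentSpace I x} (hX : CMDiffAt ∞ (T% X) x) :
      CMDiffAt (minSmoothness ℝ 2) (T% X) x := by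
    rw [minSmoothness_of_isRCLikeNormedField]
    exact hX.of_le (by norm_cast)
  have hM3 : IsManifold I (minSmoothness ℝ 3) M := by
    rw [minSmoothness_of_isRCLikeNormedField]
    infer_instance
  have key {X Y Q : Π x : M, TangentSpace I x} (hX : CMDiffAt ∞ (T% X) x)
      (hY : CMDiffAt ∞ (T% Y) x) (hQ : CMDiffAt ∞ (T% Q) x) :
      mlieBracket I X (mlieBracket I Y Q) x = cov (fun y ↦ cov Q y (Y y)) x (X x)
        - cov (fun y ↦ cov Y y (Q y)) x (X x) - cov X x (mlieBracket I Y Q x) := by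
    have h1 := hcov.contMDiffAt_cov he hx hY hQ
    have h2 := hcov.contMDiffAt_cov he hx hQ hY
    have hb := contMDiffAt_lieBracket hY hQ
    rw [hcov.bracket_eq (mdiffAt_of_smooth hX) (mdiffAt_of_smooth hb)]
    have h3 : cov (mlieBracket I Y Q) x (X x) + cov (fun y ↦ cov Y y (Q y)) x (X x)
        = cov (fun y ↦ cov Q y (Y y)) x (X x) := by
      rw [← add_apply, ← cov_add (mdiffAt_of_smooth hb) (mdiffAt_of_smooth h2),
        cov_congr (mdiffAt_of_smooth (hb.add_section h2)) (mdiffAt_of_smooth h1)]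
      filter_upwards [eventually_mdiffAt_of_smooth hY, eventually_mdiffAt_of_smooth hQ] with y h4 h5
      simp [hcov.bracket_eq h4 h5]
    rw [← h3]
    abel
  have hj := leibniz_identity_mlieBracket_apply (hms hV) (hms hW) (hms hP)
  rw [mlieBracket_swap_apply (V := mlieBracket I V W), key hV hW hP, key hP hV hW,
    key hW hV hP] at hj
  have e1 := congrArg (cov W x) (mlieBracket_swap_apply (I := I) (V := V) (W := P) (x := x))
  rw [map_neg] at e1
  rw [e1] at hj
  simp only [curvature]
  rw [← sub_eq_zero] at hj
  rw [← hj]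
  abel

end IsLeviCivita

/-- The curvature tensor `R(u,v)w` on tangent vectors. -/
def riemann (cov : CovariantDerivative I E (fun x : M ↦ TangentSpace I x)) (x : M)
    (u v w : TangentSpace I x) : TangentSpace I x :=
  curvature cov (extend E u) (extend E v) (extend E w) x

lemma contMDiffAt_extend_tangent (v : TangentSpace I x) : CMDiffAt ∞ (T% (extend E v)) x :=
  contMDiffAt_extend I E v

lemma eventually_contMDiffAt_extend (v : TangentSpace I x) :
    ∀ᶠ y in 𝓝 x, CMDiffAt ∞ (T% (extend E v)) y := by
  obtain ⟨s, hs, h⟩ := exists_contMDiffOn_extend (k := ∞) I E v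
  filter_upwards [eventually_mem_nhds_iff.2 hs] with y hy using h.contMDiffAt hy

/-! ### The curvature tensor on tangent vectors and the Ricci trace. -/

namespace IsLeviCivita

variable [Nonempty ι]

lemma riemann_eq (hcov : IsLeviCivita g cov) (he : IsOrthonormalFrameOn g e U)
    (hx : x ∈ U) (hV : CMDiffAt ∞ (T% V) x) (hW : CMDiffAt ∞ (T% W) x)
    (hP : CMDiffAt ∞ (T% P) x) :
    riemann cov x (V x) (W x) (P x) = curvature cov V W P x :=
  hcov.curvature_congr he hx (contMDiffAt_extend_tangent _) hV (contMDiffAt_extend_tangent _) hW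
    (contMDiffAt_extend_tangent _) hP (by simp) (by simp) (by simp)

lemma riemann_add (hcov : IsLeviCivita g cov) (he : IsOrthonormalFrameOn g e U)
    (hx : x ∈ U) (u u' v w : TangentSpace I x) :
    riemann cov x (u + u') v w = riemann cov x u v w + riemann cov x u' v w := by
  have h1 := contMDiffAt_extend_tangent u
  have h2 := contMDiffAt_extend_tangent u'
  have h := (hcov.curvature_tensorial₁ he hx (W := extend E v)
    (contMDiffAt_extend_tangent w)).add h1 h2
  have h' := hcov.riemann_eq he hx (h1.add_section h2) (contMDiffAt_extend_tangent v)
    (contMDiffAt_extend_tangent w)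
  simp only [Pi.add_apply, extend_apply_self] at h'
  exact h'.trans h

lemma riemann_smul (hcov : IsLeviCivita g cov) (he : IsOrthonormalFrameOn g e U)
    (hx : x ∈ U) (r : ℝ) (u v w : TangentSpace I x) :
    riemann cov x (r • u) v w = r • riemann cov x u v w := by
  have h1 := contMDiffAt_extend_tangent u
  have hc : CMDiffAt ∞ (fun _ : M ↦ r) x := contMDiffAt_const
  have h := (hcov.curvature_tensorial₁ he hx (W := extend E v)
    (contMDiffAt_extend_tangent w)).smul hc h1
  have h' := hcov.riemann_eq he hx (hc.smul_section h1) (contMDiffAt_extend_tangent v)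
    (contMDiffAt_extend_tangent w)
  simp only [Pi.smul_apply', extend_apply_self] at h'
  exact h'.trans h

lemma riemann_swap (u v w : TangentSpace I x) : riemann cov x u v w = -riemann cov x v u w :=
  curvature_swap _ _ _ x

lemma inner_riemann_skew (hcov : IsLeviCivita g cov) (he : IsOrthonormalFrameOn g e U)
    (hx : x ∈ U) (u v w z : TangentSpace I x) :
    g.inner x (riemann cov x u v w) z = -g.inner x (riemann cov x u v z) w := by
  have := hcov.inner_curvature_skew he hx (contMDiffAt_extend_tangent u)
    (contMDiffAt_extend_tangent v) (contMDiffAt_extend_tangent w) (contMDiffAt_extend_tangent z)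
  simp only [extend_apply_self] at this
  rw [g.symm x w] at this
  exact this

lemma riemann_bianchi (hcov : IsLeviCivita g cov) (he : IsOrthonormalFrameOn g e U)
    (hx : x ∈ U) (u v w z : TangentSpace I x) :
    g.inner x (riemann cov x u v w) z + g.inner x (riemann cov x v w u) z
      + g.inner x (riemann cov x w u v) z = 0 := by
  have := hcov.curvature_bianchi he hx (contMDiffAt_extend_tangent u)
    (contMDiffAt_extend_tangent v) (contMDiffAt_extend_tangent w)
  rw [← add_apply, ← add_apply, ← map_add, ← map_add]
  simp only [riemann, this, map_zero, zero_apply]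

lemma inner_riemann_swap (u v w z : TangentSpace I x) :
    g.inner x (riemann cov x u v w) z = -g.inner x (riemann cov x v u w) z := by
  rw [riemann_swap]; simp

/-- The classical octahedron argument: the four Bianchi sums obtained by rotating `u, v, w, z`,
reduced with the two skew symmetries. -/
lemma riemann_pair_symm (hcov : IsLeviCivita g cov) (he : IsOrthonormalFrameOn g e U)
    (hx : x ∈ U) (u v w z : TangentSpace I x) :
    g.inner x (riemann cov x u v w) z = g.inner x (riemann cov x w z u) v := by
  have b := hcov.riemann_bianchi he hx
  have s (a b c d) := inner_riemann_swap (g := g) (cov := cov) (x := x) a b c d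
  have k := hcov.inner_riemann_skew he hx
  linarith [b u v w z, b v w z u, b w z u v, b z u v w, s u v w z, k u v w z, s v w u z, k v w u z,
    s w u v z, k w u v z, s v w z u, k v w z u, s w z v u, k w z v u, s z v w u, k z v w u,
    s w z u v, k w z u v, s z u w v, k z u w v, s u w z v, k u w z v, s z u v w, k z u v w,
    s u v z w, k u v z w, s v z u w, k v z u w]

/-- `u ↦ R(u,v)w` as a linear map. -/
def riemannHom (hcov : IsLeviCivita g cov) (he : IsOrthonormalFrameOn g e U)
    (hx : x ∈ U) (v w : TangentSpace I x) : TangentSpace I x →ₗ[ℝ] TangentSpace I x where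
  toFun u := riemann cov x u v w
  map_add' u u' := hcov.riemann_add he hx u u' v w
  map_smul' r u := hcov.riemann_smul he hx r u v w

/-- `ricci` is written in an arbitrary basis; the trace is independent of the basis, so the
orthonormal frame may be used. -/
lemma ricci_eq_sum (hcov : IsLeviCivita g cov) (he : IsOrthonormalFrameOn g e U)
    (hx : x ∈ U) (v w : TangentSpace I x) :
    ricci cov x v w = ∑ a, g.inner x (riemann cov x (e a x) v w) (e a x) := by
  have h (κ : Type) [Fintype κ] [DecidableEq κ] (B : Module.Basis κ ℝ (TangentSpace I x)) :
      LinearMap.trace ℝ _ (hcov.riemannHom he hx v w) =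
        ∑ i, B.repr (riemann cov x (B i) v w) i := by
    rw [LinearMap.trace_eq_matrix_trace ℝ B, Matrix.trace]
    simp [LinearMap.toMatrix_apply, riemannHom]
  have h' : LinearMap.trace ℝ _ (hcov.riemannHom he hx v w) =
      ∑ a, g.inner x (riemann cov x (e a x) v w) (e a x) := by
    rw [LinearMap.trace_eq_matrix_trace ℝ (he.basis hx), Matrix.trace]
    simp [LinearMap.toMatrix_apply, riemannHom, he.basis_apply, he.basis_repr]
  rw [← h']
  exact (h _ (Module.finBasis ℝ E)).symm

end IsLeviCivita

/-! ### Curvature and Ricci form of a Kähler metric. -/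

namespace IsKahlerOn

variable {J : Π x : M, TangentSpace I x →L[ℝ] TangentSpace I x}

lemma inner_J_left (hJ : IsKahlerOn g cov J U) (hx : x ∈ U) (v w : TangentSpace I x) :
    g.inner x (J x v) w = -g.inner x v (J x w) := by
  have := hJ.orthogonal x hx v (J x w)
  rw [hJ.sq x hx] at this
  simp only [map_neg] at this
  linarith

lemma frame_J (hJ : IsKahlerOn g cov J U) (he : IsOrthonormalFrameOn g e U) :
    IsOrthonormalFrameOn g (fun a y ↦ J y (e a y)) U where
  isOpen := he.isOpen
  smooth a x hx := (hJ.smooth x hx (e a) (he.smoothAt hx a)).contMDiffWithinAt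
  inner x hx a b := by rw [hJ.orthogonal x hx, he.inner x hx]
  card := he.card

variable [Nonempty ι]

/-- A parallel `J` passes through both covariant derivatives in the commutator. -/
lemma riemann_J (hcov : IsLeviCivita g cov) (hJ : IsKahlerOn g cov J U)
    (he : IsOrthonormalFrameOn g e U) (hx : x ∈ U) (u v w : TangentSpace I x) :
    riemann cov x u v (J x w) = J x (riemann cov x u v w) := by
  have hw := contMDiffAt_extend_tangent w
  have hJw := hJ.smooth x hx _ hw
  have h0 := hcov.riemann_eq he hx (contMDiffAt_extend_tangent u) (contMDiffAt_extend_tangent v) hJw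
  simp only [extend_apply_self] at h0
  rw [h0]
  have key {X Y : Π x : M, TangentSpace I x} (hY : CMDiffAt ∞ (T% Y) x) :
      cov (fun y ↦ cov (fun z ↦ J z (extend E w z)) y (Y y)) x (X x)
        = J x (cov (fun y ↦ cov (extend E w) y (Y y)) x (X x)) := by
    have h1 := hcov.contMDiffAt_cov he hx hY hw
    rw [← hJ.parallel x hx _ h1, cov_congr
      (mdiffAt_of_smooth (hcov.contMDiffAt_cov he hx hY hJw))
      (mdiffAt_of_smooth (hJ.smooth x hx _ h1))]
    filter_upwards [he.isOpen.mem_nhds hx, eventually_contMDiffAt_extend w] with y hy hy'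
    exact hJ.parallel y hy _ hy' _
  simp only [riemann, curvature, map_sub]
  rw [key (contMDiffAt_extend_tangent u), key (contMDiffAt_extend_tangent v),
    hJ.parallel x hx _ hw]

/-- The Ricci form of a Kähler metric is half the trace of the curvature composed with `J`. -/
lemma ricciForm_eq_sum (hcov : IsLeviCivita g cov) (hJ : IsKahlerOn g cov J U)
    (he : IsOrthonormalFrameOn g e U) (hx : x ∈ U) (v w : TangentSpace I x) :
    ∑ a, g.inner x (riemann cov x v w (e a x)) (J x (e a x)) = -2 * ricciForm cov J x v w := by
  have hR := riemann_J hcov hJ he hx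
  -- Pair symmetry carries the commutation of `R(u,v)` with `J` over to the first two arguments.
  have hJJ (u v w z : TangentSpace I x) : g.inner x (riemann cov x (J x u) (J x v) w) z
      = g.inner x (riemann cov x u v w) z := by
    rw [hcov.riemann_pair_symm he hx, hR, hJ.orthogonal x hx, hcov.riemann_pair_symm he hx]
  have hric := hcov.ricci_eq_sum he hx
  have hsymm (v w : TangentSpace I x) : ricci cov x v w = ricci cov x w v := by
    rw [hric, hric]
    refine Finset.sum_congr rfl fun a _ ↦ ?_
    rw [hcov.riemann_pair_symm he hx, IsLeviCivita.inner_riemann_swap,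
      hcov.inner_riemann_skew he hx, neg_neg]
  -- The trace for the left side is taken in the orthonormal frame `J e_a`, so that all occurrences
  -- of `J` cancel.
  have hinv (v w : TangentSpace I x) : ricci cov x (J x v) (J x w) = ricci cov x v w := by
    rw [hcov.ricci_eq_sum (hJ.frame_J he) hx, hric]
    refine Finset.sum_congr rfl fun a _ ↦ ?_
    rw [hJJ, hR, hJ.orthogonal x hx]
  have hneg (v w : TangentSpace I x) : ricci cov x (-v) w = -ricci cov x v w := by
    rw [hric, hric, ← Finset.sum_neg_distrib]
    refine Finset.sum_congr rfl fun a _ ↦ ?_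
    rw [IsLeviCivita.inner_riemann_swap, ← neg_one_smul ℝ v, hcov.riemann_smul he hx,
      IsLeviCivita.inner_riemann_swap (u := e a x)]
    simp
  have h1 : ∑ a, g.inner x (riemann cov x (e a x) v w) (J x (e a x)) = -ricci cov x v (J x w) := by
    rw [hric, ← Finset.sum_neg_distrib]
    refine Finset.sum_congr rfl fun a _ ↦ ?_
    rw [hR, hJ.inner_J_left hx, neg_neg]
  have h2 : ∑ a, g.inner x (riemann cov x (e a x) w v) (J x (e a x)) = -ricci cov x w (J x v) := by
    rw [hric, ← Finset.sum_neg_distrib]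
    refine Finset.sum_congr rfl fun a _ ↦ ?_
    rw [hR, hJ.inner_J_left hx, neg_neg]
  -- Bianchi splits `R(v,w)e_a` into two terms with `e_a` in the first slot, each a Ricci trace once
  -- `J` is moved over.
  have h3 : ∑ a, g.inner x (riemann cov x v w (e a x)) (J x (e a x)) =
      ∑ a, g.inner x (riemann cov x (e a x) w v) (J x (e a x))
      - ∑ a, g.inner x (riemann cov x (e a x) v w) (J x (e a x)) := by
    rw [← Finset.sum_sub_distrib]
    refine Finset.sum_congr rfl fun a _ ↦ ?_
    linarith [hcov.riemann_bianchi he hx v w (e a x) (J x (e a x)),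
      IsLeviCivita.inner_riemann_swap (g := g) (cov := cov) w (e a x) v (J x (e a x))]
  rw [h3, h1, h2, hsymm w, ← hinv v, hJ.sq x hx, hsymm (J x v) (-w), hneg, hsymm w]
  simp only [ricciForm]
  ring

end IsKahlerOn

/-- The connection form `θ(V) = ∑ g(∇_V e_a, J e_a)` of the canonical bundle in the frame `e`. -/
def connForm (g : ContMDiffRiemannianMetric I ∞ E (fun x : M ↦ TangentSpace I x))
    (cov : CovariantDerivative I E (fun x : M ↦ TangentSpace I x))
    (J : Π x : M, TangentSpace I x →L[ℝ] TangentSpace I x) (e : ι → Π x : M, TangentSpace I x)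
    (x : M) (v : TangentSpace I x) : ℝ :=
  ∑ a, g.inner x (cov (e a) x v) (J x (e a x))

lemma mvfderiv_fun_sum {κ : Type*} (s : Finset κ) (F : κ → M → ℝ)
    (hF : ∀ a ∈ s, MDiffAt (F a) x) (v : TangentSpace I x) :
    d% (fun y ↦ ∑ a ∈ s, F a y) x v = ∑ a ∈ s, d% (F a) x v := by
  classical
  have : MDiffAt (fun y ↦ ∑ a ∈ s, F a y) x ∧
      d% (fun y ↦ ∑ a ∈ s, F a y) x v = ∑ a ∈ s, d% (F a) x v := by
    induction s using Finset.induction_on with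
    | empty =>
      simp only [Finset.sum_empty]
      exact ⟨mdifferentiableAt_const, by rw [mvfderiv_const]; rfl⟩
    | insert b s hb ih =>
      simp only [Finset.mem_insert, forall_eq_or_imp] at hF
      obtain ⟨h1, h2⟩ := ih hF.2
      simp only [Finset.sum_insert hb]
      refine ⟨hF.1.add h1, ?_⟩
      rw [mvfderiv_fun_add hF.1 h1, add_apply, h2]
  exact this.2

/-! ### The Ricci form as an exact form. -/

namespace IsKahlerOn

variable {J : Π x : M, TangentSpace I x →L[ℝ] TangentSpace I x} [Nonempty ι]

/-- In the frame, the connection matrix of `∇_v` is skew because the frame is orthonormal, while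
that of `J ∇_w` is symmetric because the matrix of `J` is constant and `J` is parallel. The trace of
a skew matrix times a symmetric one vanishes. -/
lemma sum_inner_cov_cov (hcov : IsLeviCivita g cov) (hJ : IsKahlerOn g cov J U)
    (he : IsOrthonormalFrameOn g e U)
    (hJe : ∀ a b, ∃ r, ∀ y ∈ U, g.inner y (e b y) (J y (e a y)) = r) (hx : x ∈ U)
    (v w : TangentSpace I x) :
    ∑ a, g.inner x (cov (e a) x v) (J x (cov (e a) x w)) = 0 := by
  have hconst {V W : Π x : M, TangentSpace I x} (hV : CMDiffAt ∞ (T% V) x)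
      (hW : CMDiffAt ∞ (T% W) x) {r : ℝ} (h : ∀ y ∈ U, g.inner y (V y) (W y) = r)
      (u : TangentSpace I x) :
      g.inner x (cov V x u) (W x) = -g.inner x (V x) (cov W x u) := by
    have h1 := hcov.metric x u V W (mdiffAt_of_smooth hV) (mdiffAt_of_smooth hW)
    rw [mvfderiv_congr (f₂ := fun _ ↦ r) (by
      filter_upwards [he.isOpen.mem_nhds hx] with y hy using h y hy), mvfderiv_const] at h1
    rw [zero_apply] at h1
    linarith
  have h1 (a b : ι) : g.inner x (cov (e a) x v) (e b x) = -g.inner x (cov (e b) x v) (e a x) := by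
    rw [hconst (he.smoothAt hx a) (he.smoothAt hx b) (fun y hy ↦ he.inner y hy a b), g.symm]
  have h2 (a b : ι) : g.inner x (e b x) (J x (cov (e a) x w))
      = g.inner x (J x (cov (e b) x w)) (e a x) := by
    obtain ⟨r, hr⟩ := hJe a b
    have h3 := hconst (he.smoothAt hx b) (hJ.smooth x hx _ (he.smoothAt hx a)) hr w
    rw [hJ.parallel x hx _ (he.smoothAt hx a)] at h3
    rw [hJ.inner_J_left hx, h3, neg_neg]
  have h4 : ∑ a, g.inner x (cov (e a) x v) (J x (cov (e a) x w))
      = -∑ a, g.inner x (cov (e a) x v) (J x (cov (e a) x w)) := by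
    calc _ = ∑ a, ∑ b, g.inner x (cov (e a) x v) (e b x)
            * g.inner x (e b x) (J x (cov (e a) x w)) := by
          simp_rw [he.sum_inner_mul_inner hx]
      _ = ∑ b, ∑ a, g.inner x (cov (e a) x v) (e b x)
            * g.inner x (e b x) (J x (cov (e a) x w)) := Finset.sum_comm
      _ = ∑ b, -g.inner x (cov (e b) x v) (J x (cov (e b) x w)) := by
          refine Finset.sum_congr rfl fun b _ ↦ ?_
          rw [← he.sum_inner_mul_inner hx (cov (e b) x v), ← Finset.sum_neg_distrib]
          refine Finset.sum_congr rfl fun a _ ↦ ?_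
          rw [h1, h2, g.symm x _ (e a x), g.symm x _ (e a x)]
          ring
      _ = _ := by rw [Finset.sum_neg_distrib]
  linarith

/-- The Ricci form is minus half the exterior derivative of the connection form, provided that the
matrix of `J` in the frame is constant. -/
lemma ricciForm_eq_connForm (hcov : IsLeviCivita g cov) (hJ : IsKahlerOn g cov J U)
    (he : IsOrthonormalFrameOn g e U)
    (hJe : ∀ a b, ∃ r, ∀ y ∈ U, g.inner y (e b y) (J y (e a y)) = r) (hx : x ∈ U)
    (hV : CMDiffAt ∞ (T% V) x) (hW : CMDiffAt ∞ (T% W) x) :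
    -2 * ricciForm cov J x (V x) (W x) =
      d% (fun y ↦ connForm g cov J e y (W y)) x (V x)
      - d% (fun y ↦ connForm g cov J e y (V y)) x (W x)
      - connForm g cov J e x (mlieBracket I V W x) := by
  have key {X Y : Π x : M, TangentSpace I x} (hY : CMDiffAt ∞ (T% Y) x) :
      d% (fun y ↦ connForm g cov J e y (Y y)) x (X x) =
        ∑ a, g.inner x (cov (fun y ↦ cov (e a) y (Y y)) x (X x)) (J x (e a x)) := by
    have h1 (a : ι) := hcov.contMDiffAt_cov he hx hY (he.smoothAt hx a)
    have h2 (a : ι) := hJ.smooth x hx _ (he.smoothAt hx a)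
    simp only [connForm]
    rw [mvfderiv_fun_sum _ _ fun a _ ↦
      mdiffAt_fun_of_smooth (contMDiffAt_inner (h1 a) (h2 a))]
    -- Differentiating `g(∇_Y e_a, J e_a)` produces an extra term quadratic in the connection; its
    -- sum over `a` is zero by `sum_inner_cov_cov`.
    conv_rhs => rw [← add_zero (Finset.sum _ _), ← hJ.sum_inner_cov_cov hcov he hJe hx (Y x) (X x),
      ← Finset.sum_add_distrib]
    refine Finset.sum_congr rfl fun a _ ↦ ?_
    rw [hcov.metric x _ _ _ (mdiffAt_of_smooth (h1 a)) (mdiffAt_of_smooth (h2 a)),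
      hJ.parallel x hx _ (he.smoothAt hx a)]
  rw [key hV, key hW, ← hJ.ricciForm_eq_sum hcov he hx, connForm, ← Finset.sum_sub_distrib,
    ← Finset.sum_sub_distrib]
  refine Finset.sum_congr rfl fun a _ ↦ ?_
  rw [hcov.riemann_eq he hx hV hW (he.smoothAt hx a), curvature]
  simp only [map_sub, sub_apply]

end IsKahlerOn

/-! ### The Hessian, and reduction of both soliton equations. -/

section Hessian

variable {J : Π x : M, TangentSpace I x →L[ℝ] TangentSpace I x} [Nonempty ι]

lemma contMDiffAt_grad (he : IsOrthonormalFrameOn g e U) (hx : x ∈ U) (hf : CMDiff[U] ∞ f) :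
    CMDiffAt ∞ (T% (grad g f)) x := by
  refine contMDiffAt_of_inner he hx fun a ↦ ?_
  simp only [inner_grad]
  exact contMDiffAt_dir he hx (hf.contMDiffAt (he.isOpen.mem_nhds hx)) (he.smoothAt hx a)

/-- Since `∇` is torsion-free and metric, the skew part of the Hessian is `VWf - WVf - [V,W]f = 0`.
-/
lemma hess_symm (hcov : IsLeviCivita g cov) (he : IsOrthonormalFrameOn g e U) (hx : x ∈ U)
    (hf : CMDiff[U] ∞ f) (v w : TangentSpace I x) : hess g cov f x v w = hess g cov f x w v := by
  have hN := contMDiffAt_grad (g := g) he hx hf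
  have hv := contMDiffAt_extend_tangent v
  have hw := contMDiffAt_extend_tangent w
  have h := dir_bracket he hx (hf.contMDiffAt (he.isOpen.mem_nhds hx)) hv hw
  have hd (Y : Π x : M, TangentSpace I x) :
      (fun y ↦ d% f y (Y y)) = fun y ↦ g.inner y (grad g f y) (Y y) := by
    funext y; rw [inner_grad]
  rw [hd, hd, ← inner_grad g] at h
  rw [hcov.metric x _ _ _ (mdiffAt_of_smooth hN) (mdiffAt_of_smooth hv),
    hcov.metric x _ _ _ (mdiffAt_of_smooth hN) (mdiffAt_of_smooth hw),
    hcov.bracket_eq (mdiffAt_of_smooth hv) (mdiffAt_of_smooth hw)] at h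
  simp only [extend_apply_self, map_sub] at h
  simp only [hess]
  linarith

/-- The skew part of the Hessian is half the exterior derivative of `g(J∇f, ·)`. -/
lemma IsKahlerOn.hess_skew (hcov : IsLeviCivita g cov) (hJ : IsKahlerOn g cov J U)
    (he : IsOrthonormalFrameOn g e U) (hx : x ∈ U) (hf : CMDiff[U] ∞ f)
    (hV : CMDiffAt ∞ (T% V) x) (hW : CMDiffAt ∞ (T% W) x) :
    hess g cov f x (J x (V x)) (W x) - hess g cov f x (J x (W x)) (V x) =
      d% (fun y ↦ g.inner y (J y (grad g f y)) (W y)) x (V x)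
      - d% (fun y ↦ g.inner y (J y (grad g f y)) (V y)) x (W x)
      - g.inner x (J x (grad g f x)) (mlieBracket I V W x) := by
  have hN := contMDiffAt_grad (g := g) he hx hf
  have hJN := hJ.smooth x hx _ hN
  rw [hcov.metric x _ _ _ (mdiffAt_of_smooth hJN) (mdiffAt_of_smooth hV),
    hcov.metric x _ _ _ (mdiffAt_of_smooth hJN) (mdiffAt_of_smooth hW),
    hcov.bracket_eq (mdiffAt_of_smooth hV) (mdiffAt_of_smooth hW), hJ.parallel x hx _ hN,
    hJ.parallel x hx _ hN, hJ.inner_J_left hx, hJ.inner_J_left hx (cov (grad g f) x (W x)),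
    hess_symm hcov he hx hf, hess_symm hcov he hx hf (J x (W x))]
  simp only [hess, map_sub]
  ring

/-- The skew-soliton equation holds if it holds, in terms of exterior derivatives, on a family of
smooth fields proportional to an orthonormal frame. -/
lemma IsKahlerOn.isSkewSolitonOn (hcov : IsLeviCivita g cov) (hJ : IsKahlerOn g cov J U)
    (he : IsOrthonormalFrameOn g e U)
    (hJe : ∀ a b, ∃ r, ∀ y ∈ U, g.inner y (e b y) (J y (e a y)) = r)
    (hf : CMDiff[U] ∞ f) {lam : ℝ} {F : ι → Π x : M, TangentSpace I x}
    (hF : ∀ a, CMDiff[U] ∞ (T% (F a))) (l : ι → M → ℝ) (hFe : ∀ x ∈ U, ∀ a, e a x = l a x • F a x)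
    (η : Π x : M, TangentSpace I x → ℝ)
    (hη : ∀ x ∈ U, ∀ v, η x v =
      -(1 / 2) * connForm g cov J e x v + 1 / 2 * g.inner x (J x (grad g f x)) v)
    (h : ∀ x ∈ U, ∀ a b, d% (fun y ↦ η y (F b y)) x (F a x) - d% (fun y ↦ η y (F a y)) x (F b x)
      - η x (mlieBracket I (F a) (F b) x) = lam * kahlerForm g J x (F a x) (F b x)) :
    IsSkewSolitonOn g cov J f lam U where
  kahler := hJ
  smooth := hf
  eqn x hx v w := by
    have hFx (a : ι) : CMDiffAt ∞ (T% (F a)) x := (hF a).contMDiffAt (he.isOpen.mem_nhds hx)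
    have hJN := hJ.smooth x hx _ (contMDiffAt_grad (g := g) he hx hf)
    have hθ (a : ι) : CMDiffAt ∞ (fun y ↦ connForm g cov J e y (F a y)) x :=
      contMDiffAt_finsetSum fun b _ ↦ contMDiffAt_inner
        (hcov.contMDiffAt_cov he hx (hFx a) (he.smoothAt hx b))
        (hJ.smooth x hx _ (he.smoothAt hx b))
    have hd (a : ι) (u : TangentSpace I x) : d% (fun y ↦ η y (F a y)) x u =
        -(1 / 2) * d% (fun y ↦ connForm g cov J e y (F a y)) x u
        + 1 / 2 * d% (fun y ↦ g.inner y (J y (grad g f y)) (F a y)) x u := by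
      have h1 := mdiffAt_fun_of_smooth (hθ a)
      have h2 := mdiffAt_fun_of_smooth (contMDiffAt_inner (g := g) hJN (hFx a))
      have hc (r : ℝ) : MDiffAt (fun _ : M ↦ r) x := mdifferentiableAt_const
      have h3 : MDiffAt (fun y ↦ -(1 / 2) * connForm g cov J e y (F a y)) x := (hc _).mul h1
      have h4 : MDiffAt (fun y ↦ 1 / 2 * g.inner y (J y (grad g f y)) (F a y)) x := (hc _).mul h2
      rw [mvfderiv_congr (f₂ := fun y ↦ -(1 / 2) * connForm g cov J e y (F a y)
          + 1 / 2 * g.inner y (J y (grad g f y)) (F a y)) (by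
        filter_upwards [he.isOpen.mem_nhds hx] with y hy using hη y hy _),
        mvfderiv_fun_add h3 h4, mvfderiv_fun_mul (hc _) h1,
        mvfderiv_fun_mul (hc _) h2, mvfderiv_const, mvfderiv_const]
      simp
    have hF' (a b : ι) : ricciForm cov J x (F a x) (F b x) + 1 / 2 *
        (hess g cov f x (J x (F a x)) (F b x) - hess g cov f x (J x (F b x)) (F a x))
        = lam * kahlerForm g J x (F a x) (F b x) := by
      rw [← h x hx a b, hd, hd, hη x hx, hJ.hess_skew hcov he hx hf (hFx a) (hFx b)]
      linarith [hJ.ricciForm_eq_connForm hcov he hJe hx (hFx a) (hFx b)]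
    -- Bilinearity and skew symmetry of the Ricci form are read off from the curvature trace, where
    -- they are evident in the first two arguments.
    have hadd (u u' w : TangentSpace I x) : ricciForm cov J x (u + u') w
        = ricciForm cov J x u w + ricciForm cov J x u' w := by
      have h0 := hJ.ricciForm_eq_sum hcov he hx
      have : -2 * ricciForm cov J x (u + u') w
          = -2 * ricciForm cov J x u w + -2 * ricciForm cov J x u' w := by
        rw [← h0, ← h0, ← h0, ← Finset.sum_add_distrib]
        simp [hcov.riemann_add he hx]
      linarith
    have hsmul (r : ℝ) (u w : TangentSpace I x) : ricciForm cov J x (r • u) w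
        = r * ricciForm cov J x u w := by
      have h0 := hJ.ricciForm_eq_sum hcov he hx
      have : -2 * ricciForm cov J x (r • u) w = r * (-2 * ricciForm cov J x u w) := by
        rw [← h0, ← h0, Finset.mul_sum]
        simp [hcov.riemann_smul he hx]
      linarith
    have hswap (u w : TangentSpace I x) : ricciForm cov J x u w = -ricciForm cov J x w u := by
      have h0 := hJ.ricciForm_eq_sum hcov he hx
      have : -2 * ricciForm cov J x u w = -(-2 * ricciForm cov J x w u) := by
        rw [← h0, ← h0, ← Finset.sum_neg_distrib]
        exact Finset.sum_congr rfl fun a _ ↦ IsLeviCivita.inner_riemann_swap _ _ _ _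
      linarith
    -- The defect of the equation is bilinear, so its vanishing on multiples of basis vectors is
    -- enough.
    let B : TangentSpace I x →ₗ[ℝ] TangentSpace I x →ₗ[ℝ] ℝ := LinearMap.mk₂ ℝ
      (fun v w ↦ ricciForm cov J x v w + 1 / 2 *
        (hess g cov f x (J x v) w - hess g cov f x (J x w) v) - lam * kahlerForm g J x v w)
      (fun u u' w ↦ by simp only [hadd, hess, kahlerForm, map_add, add_apply]; ring)
      (fun r u w ↦ by
        simp only [hsmul, hess, kahlerForm, map_smul, smul_apply, smul_eq_mul]; ring)
      (fun u w w' ↦ by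
        simp only [hswap u, hadd, hess, kahlerForm, map_add, add_apply]; ring)
      (fun r u w ↦ by
        simp only [hswap u, hsmul, hess, kahlerForm, map_smul, smul_apply, smul_eq_mul]; ring)
    have hB : B = 0 := by
      refine (he.basis hx).ext fun a ↦ (he.basis hx).ext fun b ↦ ?_
      rw [he.basis_apply, he.basis_apply, hFe x hx, hFe x hx]
      simp only [map_smul, LinearMap.smul_apply, B, LinearMap.mk₂_apply, hF', sub_self, smul_zero,
        LinearMap.zero_apply]
    have := congrArg (fun C ↦ C v w) hB
    simp only [B, LinearMap.mk₂_apply, LinearMap.zero_apply] at this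
    linarith

/-- A skew-soliton whose potential has holomorphic gradient is a Kähler-Ricci soliton. -/
lemma IsSkewSolitonOn.isKahlerRicciSolitonOn (hcov : IsLeviCivita g cov)
    (he : IsOrthonormalFrameOn g e U) {lam : ℝ} (hs : IsSkewSolitonOn g cov J f lam U)
    (hol : ∀ x ∈ U, ∀ a, cov (grad g f) x (J x (e a x)) = J x (cov (grad g f) x (e a x))) :
    IsKahlerRicciSolitonOn g cov J f lam U := by
  have hJ := hs.kahler
  have hol' (x : M) (hx : x ∈ U) (v : TangentSpace I x) :
      cov (grad g f) x (J x v) = J x (cov (grad g f) x v) := by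
    conv_lhs => rw [← he.sum_inner_smul hx v]
    conv_rhs => rw [← he.sum_inner_smul hx v]
    simp [hol x hx]
  refine ⟨hJ, hs.smooth, fun x hx V hV ↦ ?_, fun x hx V W hV hW ↦ ?_⟩
  -- With `∇` torsion-free and `∇J = 0`, the value of `L_X J` on `V` is `J∇_V X - ∇_{JV} X`, which
  -- `hol'` makes zero.
  · have hN := mdiffAt_of_smooth (contMDiffAt_grad (g := g) he hx hs.smooth)
    rw [hcov.bracket_eq hN (mdiffAt_of_smooth hV),
      hcov.bracket_eq hN (mdiffAt_of_smooth (hJ.smooth x hx V hV)), hJ.parallel x hx V hV, hol' x hx,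
      map_sub]
  · have hN := mdiffAt_of_smooth (contMDiffAt_grad (g := g) he hx hs.smooth)
    have hJV := hJ.smooth x hx V hV
    rw [← hs.eqn x hx]
    simp only [kahlerForm, hess]
    rw [hcov.bracket_eq hN (mdiffAt_of_smooth hV), hcov.bracket_eq hN (mdiffAt_of_smooth hW),
      hcov.metric x _ _ _ (mdiffAt_of_smooth hJV) (mdiffAt_of_smooth hW), hJ.parallel x hx V hV,
      hol' x hx, hol' x hx, hJ.inner_J_left hx (cov (grad g f) x (W x)),
      g.symm x (cov (grad g f) x (W x))]
    simp only [map_sub, sub_apply]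
    ring

end Hessian

end Frames

/-! ### The diagonal metric: frame, brackets, connection coefficients. -/

section Diagonal

variable {E : Type*} [NormedAddCommGroup E] [NormedSpace ℝ E] [FiniteDimensional ℝ E]
  {H : Type*} [TopologicalSpace H] {I : ModelWithCorners ℝ E H}
  {M : Type*} [TopologicalSpace M] [ChartedSpace H M] [IsManifold I ∞ M]
  {E' : Type*} [NormedAddCommGroup E'] [NormedSpace ℝ E']
  {H' : Type*} [TopologicalSpace H'] {I' : ModelWithCorners ℝ E' H'}
  {G : Type*} [TopologicalSpace G] [ChartedSpace H' G] [Group G] [MulAction G M]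
  {n : ℕ} {g : ContMDiffRiemannianMetric I ∞ E (fun x : M ↦ TangentSpace I x)}
  {cov : CovariantDerivative I E (fun x : M ↦ TangentSpace I x)}
  {U : Set M} {S : Set ℝ} {t : M → ℝ}
  {T Z : Π x : M, TangentSpace I x} {X Y : Fin n → Π x : M, TangentSpace I x}
  {Γz Γx Γy : Fin n → ℝ} {a b : Fin n → ℝ → ℝ} {c : ℝ → ℝ}
  {J : Π x : M, TangentSpace I x →L[ℝ] TangentSpace I x} {x : M}

/-- The frame `T, Z, X_i, Y_i` as a family indexed by pairs: the second component `true` marks the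
image under `J`, up to a factor. -/
def rawFrame (T Z : Π x : M, TangentSpace I x) (X Y : Fin n → Π x : M, TangentSpace I x) :
    Option (Fin n) × Bool → Π x : M, TangentSpace I x
  | (none, false) => T
  | (none, true) => Z
  | (some i, false) => X i
  | (some i, true) => Y i

/-- The length of the members of `rawFrame`. -/
def len (a b : Fin n → ℝ → ℝ) (c : ℝ → ℝ) : Option (Fin n) × Bool → ℝ → ℝ
  | (none, false) => fun s ↦ prodAB a b s * c s
  | (none, true) => c
  | (some i, false) => a i
  | (some i, true) => b i

/-- The normalized frame. -/
def unitFrame (t : M → ℝ) (T Z : Π x : M, TangentSpace I x)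
    (X Y : Fin n → Π x : M, TangentSpace I x) (a b : Fin n → ℝ → ℝ) (c : ℝ → ℝ)
    (p : Option (Fin n) × Bool) : Π x : M, TangentSpace I x :=
  (fun x ↦ (len a b c p (t x))⁻¹) • rawFrame T Z X Y p

/-- The coefficient of the bracket of two members of `rawFrame`, see `bracket_rawFrame`. -/
def brCoeff (Γz Γx Γy : Fin n → ℝ) : Option (Fin n) × Bool → Option (Fin n) × Bool → ℝ
  | (some i, false), (some j, true) => if i = j then -Γz i else 0
  | (some i, true), (some j, false) => if i = j then Γz i else 0
  | (some i, true), (none, true) => -Γx i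
  | (none, true), (some i, true) => Γx i
  | (none, true), (some i, false) => -Γy i
  | (some i, false), (none, true) => Γy i
  | _, _ => 0

/-- The index of the field to which the bracket of two members of `rawFrame` is proportional. -/
def brIndex : Option (Fin n) × Bool → Option (Fin n) × Bool → Option (Fin n) × Bool
  | (some _, false), (some _, true) => (none, true)
  | (some _, true), (some _, false) => (none, true)
  | (some i, true), (none, true) => (some i, false)
  | (none, true), (some i, true) => (some i, false)
  | (none, true), (some i, false) => (some i, true)
  | (some i, false), (none, true) => (some i, true)
  | _, _ => (none, false)

lemma unitFrame_apply (p : Option (Fin n) × Bool) (x : M) :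
    unitFrame t T Z X Y a b c p x = (len a b c p (t x))⁻¹ • rawFrame T Z X Y p x := rfl

lemma mvfderiv_comp_real {φ : ℝ → ℝ} (hφ : DifferentiableAt ℝ φ (t x)) (ht : MDiffAt t x)
    (v : TangentSpace I x) : d% (fun y ↦ φ (t y)) x v = deriv φ (t x) * d% t x v := by
  have h := mvfderiv_comp_apply (I := 𝓘(ℝ, ℝ)) (I' := I) (g := φ) (f := t) x
    hφ.mdifferentiableAt ht v
  refine Eq.trans h ?_
  simp only [mvfderiv, mfderiv_eq_fderiv]
  exact fderiv_eq_deriv_mul (𝕜 := ℝ) (f := φ) (x := t x) (y := mfderiv I 𝓘(ℝ, ℝ) t x v)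

namespace IsDiagonalCohomOne

variable (hM : IsDiagonalCohomOne n g I' G U S t T Z X Y Γz Γx Γy a b c J)
include hM

lemma mem_S (hx : x ∈ U) : t x ∈ S := hM.t_image ▸ mem_image_of_mem t hx

lemma contMDiffOn_comp {φ : ℝ → ℝ} (hφ : ContDiffOn ℝ ∞ φ S) :
    CMDiff[U] ∞ (fun x ↦ φ (t x)) :=
  hφ.contMDiffOn.comp hM.t_smooth fun _ hx ↦ hM.mem_S hx

lemma differentiableAt_of_contDiffOn {φ : ℝ → ℝ} (hφ : ContDiffOn ℝ ∞ φ S) {s : ℝ} (hs : s ∈ S) :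
    DifferentiableAt ℝ φ s :=
  (hφ.contDiffAt (hM.isOpen_S.mem_nhds hs)).differentiableAt (by simp)

lemma mdiffAt_t (hx : x ∈ U) : MDiffAt t x :=
  (hM.t_smooth.contMDiffAt (hM.isOpen_U.mem_nhds hx)).mdifferentiableAt (by simp)

lemma dir_comp {φ : ℝ → ℝ} (hφ : ContDiffOn ℝ ∞ φ S) (hx : x ∈ U) (v : TangentSpace I x) :
    d% (fun y ↦ φ (t y)) x v = deriv φ (t x) * d% t x v :=
  mvfderiv_comp_real (hM.differentiableAt_of_contDiffOn hφ (hM.mem_S hx)) (hM.mdiffAt_t hx) v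

lemma prodAB_pos {s : ℝ} (hs : s ∈ S) : 0 < prodAB a b s :=
  Finset.prod_pos fun i _ ↦ mul_pos (hM.a_pos i s hs) (hM.b_pos i s hs)

lemma prodAB_smooth : ContDiffOn ℝ ∞ (prodAB a b) S :=
  contDiffOn_prod fun i _ ↦ (hM.a_smooth i).mul (hM.b_smooth i)

lemma len_pos (p : Option (Fin n) × Bool) {s : ℝ} (hs : s ∈ S) : 0 < len a b c p s := by
  rcases p with ⟨_ | i, _ | _⟩
  · exact mul_pos (hM.prodAB_pos hs) (hM.c_pos s hs)
  · exact hM.c_pos s hs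
  · exact hM.a_pos i s hs
  · exact hM.b_pos i s hs

lemma len_smooth (p : Option (Fin n) × Bool) : ContDiffOn ℝ ∞ (len a b c p) S := by
  rcases p with ⟨_ | i, _ | _⟩
  · exact hM.prodAB_smooth.mul hM.c_smooth
  · exact hM.c_smooth
  · exact hM.a_smooth i
  · exact hM.b_smooth i

lemma inv_len_smooth (p : Option (Fin n) × Bool) :
    ContDiffOn ℝ ∞ (fun s ↦ (len a b c p s)⁻¹) S :=
  (hM.len_smooth p).inv fun _ hs ↦ (hM.len_pos p hs).ne'

lemma rawFrame_smooth (p : Option (Fin n) × Bool) : CMDiff[U] ∞ (T% (rawFrame T Z X Y p)) := by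
  rcases p with ⟨_ | i, _ | _⟩
  · exact hM.T_smooth
  · exact hM.Z_smooth
  · exact hM.X_smooth i
  · exact hM.Y_smooth i

lemma rawFrame_mdiffAt (p : Option (Fin n) × Bool) (hx : x ∈ U) :
    MDiffAt (T% (rawFrame T Z X Y p)) x :=
  mdiffAt_of_smooth ((hM.rawFrame_smooth p).contMDiffAt (hM.isOpen_U.mem_nhds hx))

lemma inner_rawFrame (p q : Option (Fin n) × Bool) (hx : x ∈ U) :
    g.inner x (rawFrame T Z X Y p x) (rawFrame T Z X Y q x)
      = if p = q then len a b c p (t x) ^ 2 else 0 := by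
  rcases p with ⟨_ | i, _ | _⟩ <;> rcases q with ⟨_ | j, _ | _⟩ <;> simp only [rawFrame, len]
  · simp [hM.g_T_T x hx, mul_pow]
  · simp [hM.g_T_Z x hx]
  · simp [hM.g_T_X j x hx]
  · simp [hM.g_T_Y j x hx]
  · simp [g.symm x (Z x), hM.g_T_Z x hx]
  · simp [hM.g_Z_Z x hx]
  · simp [hM.g_Z_X j x hx]
  · simp [hM.g_Z_Y j x hx]
  · simp [g.symm x _ (T x), hM.g_T_X i x hx]
  · simp [g.symm x _ (Z x), hM.g_Z_X i x hx]
  · by_cases h : i = j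
    · subst h; simp [hM.g_X_X i x hx]
    · simp [hM.g_X_X_ne i j h x hx, h]
  · simp [hM.g_X_Y i j x hx]
  · simp [g.symm x _ (T x), hM.g_T_Y i x hx]
  · simp [g.symm x _ (Z x), hM.g_Z_Y i x hx]
  · simp [g.symm x (Y i x), hM.g_X_Y j i x hx]
  · by_cases h : i = j
    · subst h; simp [hM.g_Y_Y i x hx]
    · simp [hM.g_Y_Y_ne i j h x hx, h]

lemma dt_rawFrame (p : Option (Fin n) × Bool) (hx : x ∈ U) :
    d% t x (rawFrame T Z X Y p x) = if p = (none, false) then 1 else 0 := by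
  rcases p with ⟨_ | i, _ | _⟩ <;> simp only [rawFrame]
  · simp [hM.dt_T x hx]
  · simp [hM.dt_Z x hx]
  · simp [hM.dt_X i x hx]
  · simp [hM.dt_Y i x hx]

lemma bracket_rawFrame (p q : Option (Fin n) × Bool) (hx : x ∈ U) :
    mlieBracket I (rawFrame T Z X Y p) (rawFrame T Z X Y q) x
      = brCoeff Γz Γx Γy p q • rawFrame T Z X Y (brIndex p q) x := by
  rcases p with ⟨_ | i, _ | _⟩ <;> rcases q with ⟨_ | j, _ | _⟩ <;>
    simp only [rawFrame, brCoeff, brIndex]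
  · simp
  · simp [hM.lie_T_Z x hx]
  · simp [hM.lie_T_X j x hx]
  · simp [hM.lie_T_Y j x hx]
  · simp [mlieBracket_swap_apply (V := Z), hM.lie_T_Z x hx]
  · simp
  · simp [hM.lie_Z_X j x hx]
  · simp [mlieBracket_swap_apply (V := Z), hM.lie_Y_Z j x hx]
  · simp [mlieBracket_swap_apply (W := T), hM.lie_T_X i x hx]
  · simp [mlieBracket_swap_apply (W := Z), hM.lie_Z_X i x hx]
  · by_cases h : i = j
    · subst h; simp
    · simp [hM.lie_X_X i j h x hx]
  · by_cases h : i = j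
    · subst h; simp [hM.lie_X_Y i x hx]
    · simp [hM.lie_X_Y_ne i j h x hx, h]
  · simp [mlieBracket_swap_apply (W := T), hM.lie_T_Y i x hx]
  · simp [hM.lie_Y_Z i x hx]
  · by_cases h : i = j
    · subst h; simp [mlieBracket_swap_apply (W := X i), hM.lie_X_Y i x hx]
    · simp [mlieBracket_swap_apply (W := X j), hM.lie_X_Y_ne j i (Ne.symm h) x hx, h]
  · by_cases h : i = j
    · subst h; simp
    · simp [hM.lie_Y_Y i j h x hx]

lemma rawFrame_apply (p : Option (Fin n) × Bool) (hx : x ∈ U) :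
    rawFrame T Z X Y p x = len a b c p (t x) • unitFrame t T Z X Y a b c p x := by
  rw [unitFrame_apply, smul_smul, mul_inv_cancel₀ (hM.len_pos p (hM.mem_S hx)).ne', one_smul]

lemma isOrthonormalFrameOn : IsOrthonormalFrameOn g (unitFrame t T Z X Y a b c) U where
  isOpen := hM.isOpen_U
  smooth p := (hM.contMDiffOn_comp (hM.inv_len_smooth p)).smul_section (hM.rawFrame_smooth p)
  inner x hx p q := by
    rw [unitFrame_apply, unitFrame_apply]
    simp only [map_smul, smul_apply, hM.inner_rawFrame p q hx, smul_eq_mul]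
    have := (hM.len_pos p (hM.mem_S hx)).ne'
    split_ifs with h
    · subst h
      field_simp
    · simp
  card := by
    rw [hM.dim_M]
    simp
    ring

/-- The Gram matrix is diagonal and depends on `t` only, so only lengths differentiated along `T`
contribute. -/
lemma dir_inner_rawFrame (p q r : Option (Fin n) × Bool) (hx : x ∈ U) :
    d% (fun y ↦ g.inner y (rawFrame T Z X Y q y) (rawFrame T Z X Y r y)) x (rawFrame T Z X Y p x)
      = if q = r ∧ p = (none, false) then 2 * len a b c q (t x) * deriv (len a b c q) (t x)
        else 0 := by
  by_cases h : q = r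
  · subst h
    rw [mvfderiv_congr (f₂ := fun y ↦ (fun s ↦ len a b c q s ^ 2) (t y)) (by
      filter_upwards [hM.isOpen_U.mem_nhds hx] with y hy
      rw [hM.inner_rawFrame q q hy, if_pos rfl]),
      hM.dir_comp ((hM.len_smooth q).pow 2) hx, hM.dt_rawFrame p hx,
      deriv_fun_pow (hM.differentiableAt_of_contDiffOn (hM.len_smooth q) (hM.mem_S hx))]
    simp
  · rw [mvfderiv_congr (f₂ := fun y ↦ (0 : ℝ)) (by
      filter_upwards [hM.isOpen_U.mem_nhds hx] with y hy
      rw [hM.inner_rawFrame q r hy, if_neg h]), mvfderiv_const]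
    simp [h]

end IsDiagonalCohomOne

/-- Twice the coefficient `g(∇_{F_p} F_q, F_r)` of the Levi-Civita connection in the frame
`F = rawFrame`, for `q ≠ r`, see `inner_cov_rawFrame`. -/
def connNum (Γz Γx Γy : Fin n → ℝ) (a b : Fin n → ℝ → ℝ) (c : ℝ → ℝ)
    (p q r : Option (Fin n) × Bool) (s : ℝ) : ℝ :=
  (if p = r ∧ q = (none, false) then 2 * len a b c p s * deriv (len a b c p) s else 0)
  - (if p = q ∧ r = (none, false) then 2 * len a b c p s * deriv (len a b c p) s else 0)
  + (if brIndex p q = r then brCoeff Γz Γx Γy p q * len a b c r s ^ 2 else 0)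
  - (if brIndex p r = q then brCoeff Γz Γx Γy p r * len a b c q s ^ 2 else 0)
  - (if brIndex q r = p then brCoeff Γz Γx Γy q r * len a b c p s ^ 2 else 0)

/-- `connNum` leaves out the derivative of the length of `F_q`, so its diagonal value is the one
right for a unit field, `g(∇e, e) = 0`. -/
lemma connNum_self (p q : Option (Fin n) × Bool) (s : ℝ) :
    connNum Γz Γx Γy a b c p q q s = 0 := by
  have : brCoeff Γz Γx Γy q q = 0 := by
    rcases q with ⟨_ | i, _ | _⟩ <;> rfl
  simp [connNum, this]

/-- The index of the image of a member of the frame under `J`. -/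
def star (p : Option (Fin n) × Bool) : Option (Fin n) × Bool := (p.1, !p.2)

/-- The sign in `J e_p = ± e_{star p}`. -/
def sgn (p : Option (Fin n) × Bool) : ℝ := if p.2 then -1 else 1

namespace IsDiagonalCohomOne

lemma J_unitFrame (hM : IsDiagonalCohomOne n g I' G U S t T Z X Y Γz Γx Γy a b c J)
    (p : Option (Fin n) × Bool) (hx : x ∈ U) :
    J x (unitFrame t T Z X Y a b c p x) = sgn p • unitFrame t T Z X Y a b c (star p) x := by
  have hP := (hM.prodAB_pos (hM.mem_S hx)).ne'
  have hc := (hM.c_pos _ (hM.mem_S hx)).ne'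
  rw [unitFrame_apply, unitFrame_apply, map_smul]
  rcases p with ⟨_ | i, _ | _⟩ <;> simp only [rawFrame, len, sgn, star, Bool.not_false,
    Bool.not_true, if_true, Bool.false_eq_true, if_false]
  · rw [hM.J_T x hx, smul_smul, one_smul]
    congr 1
    field_simp
  · rw [hM.J_Z x hx, smul_neg, smul_smul, smul_smul, neg_one_mul, neg_smul]
    congr 2
    field_simp
  · have ha := (hM.a_pos i _ (hM.mem_S hx)).ne'
    rw [hM.J_X i x hx, smul_smul, one_smul]
    congr 1
    field_simp
  · have hb := (hM.b_pos i _ (hM.mem_S hx)).ne'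
    rw [hM.J_Y i x hx, smul_neg, smul_smul, smul_smul, neg_one_mul, neg_smul]
    congr 2
    field_simp

lemma inner_cov_rawFrame (hM : IsDiagonalCohomOne n g I' G U S t T Z X Y Γz Γx Γy a b c J)
    (hcov : IsLeviCivita g cov) (hx : x ∈ U) (p : Option (Fin n) × Bool)
    {q r : Option (Fin n) × Bool} (hqr : q ≠ r) :
    2 * g.inner x (cov (rawFrame T Z X Y q) x (rawFrame T Z X Y p x)) (rawFrame T Z X Y r x)
      = connNum Γz Γx Γy a b c p q r (t x) := by
  rw [hcov.koszul (hM.rawFrame_mdiffAt p hx) (hM.rawFrame_mdiffAt q hx)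
    (hM.rawFrame_mdiffAt r hx), hM.dir_inner_rawFrame _ _ _ hx, hM.dir_inner_rawFrame _ _ _ hx,
    hM.dir_inner_rawFrame _ _ _ hx, hM.bracket_rawFrame _ _ hx, hM.bracket_rawFrame _ _ hx,
    hM.bracket_rawFrame _ _ hx]
  simp only [map_smul, smul_apply, hM.inner_rawFrame _ _ hx, smul_eq_mul, mul_ite, mul_zero,
    connNum, hqr, false_and, if_false, zero_add]
  congr 1
  · congr 1
    · congr 1
      split_ifs with h
      · rw [h]
      · rfl
    · split_ifs with h
      · rw [h]
      · rfl
  · split_ifs with h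
    · rw [h]
    · rfl

/-- Normalizing `F_q` adds to its derivative only a multiple of `F_q`, invisible to the other frame
vectors; for `r = q` both sides vanish. -/
lemma inner_cov_unitFrame (hM : IsDiagonalCohomOne n g I' G U S t T Z X Y Γz Γx Γy a b c J)
    (hcov : IsLeviCivita g cov) (hx : x ∈ U) (p q r : Option (Fin n) × Bool) :
    g.inner x (cov (unitFrame t T Z X Y a b c q) x (rawFrame T Z X Y p x))
        (unitFrame t T Z X Y a b c r x)
      = connNum Γz Γx Γy a b c p q r (t x) / (2 * len a b c q (t x) * len a b c r (t x)) := by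
  have he := hM.isOrthonormalFrameOn
  by_cases hqr : q = r
  · subst hqr
    have hs := mdiffAt_of_smooth (he.smoothAt hx q)
    have h := hcov.metric x (rawFrame T Z X Y p x) _ _ hs hs
    rw [mvfderiv_congr (f₂ := fun _ ↦ (1 : ℝ)) (by
      filter_upwards [hM.isOpen_U.mem_nhds hx] with y hy
      rw [he.inner y hy, if_pos rfl]), mvfderiv_const, g.symm x (unitFrame t T Z X Y a b c q x),
      zero_apply] at h
    rw [connNum_self, zero_div]
    linarith
  · have hl := (hM.contMDiffOn_comp (hM.inv_len_smooth q)).contMDiffAt (hM.isOpen_U.mem_nhds hx)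
    have h1 := hM.inner_cov_rawFrame hcov hx p hqr
    have h2 := hM.inner_rawFrame q r hx
    rw [if_neg hqr] at h2
    rw [show cov (unitFrame t T Z X Y a b c q) x (rawFrame T Z X Y p x) = _ from
      cov_smul (mdiffAt_fun_of_smooth hl) (hM.rawFrame_mdiffAt q hx) _, unitFrame_apply, ← h1]
    simp only [map_add, map_smul, add_apply, smul_apply, smul_eq_mul, h2]
    have := (hM.len_pos q (hM.mem_S hx)).ne'
    have := (hM.len_pos r (hM.mem_S hx)).ne'
    field_simp
    ring

end IsDiagonalCohomOne

/-- The compatibility of the connection coefficients with `J`. -/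
lemma connNum_star {s : ℝ} (hP : 0 < prodAB a b s) (ha : ∀ i, 0 < a i s) (hb : ∀ i, 0 < b i s)
    (hc : 0 < c s)
    (hda : ∀ i, deriv (a i) s =
      prodAB a b s / (2 * b i s) * (Γz i * c s ^ 2 - Γx i * a i s ^ 2 + Γy i * b i s ^ 2))
    (hdb : ∀ i, deriv (b i) s =
      prodAB a b s / (2 * a i s) * (Γz i * c s ^ 2 + Γx i * a i s ^ 2 - Γy i * b i s ^ 2))
    (p q r : Option (Fin n) × Bool) :
    sgn q * (connNum Γz Γx Γy a b c p (star q) r s / (2 * len a b c (star q) s * len a b c r s)) =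
      -(sgn r * (connNum Γz Γx Γy a b c p q (star r) s
        / (2 * len a b c q s * len a b c (star r) s))) := by
  have hP' := hP.ne'
  have hc' := hc.ne'
  have ha' (i) := (ha i).ne'
  have hb' (i) := (hb i).ne'
  -- Ten index patterns survive simplification. The two with `p` the index of `Z` express skew
  -- symmetry in the last two indices; the four with `p` an `X_i` use `a_i'`, the four with a `Y_i`
  -- use `b_i'`.
  rcases p with ⟨_ | i, _ | _⟩ <;> rcases q with ⟨_ | j, _ | _⟩ <;> rcases r with ⟨_ | k, _ | _⟩ <;>
    simp only [connNum, star, sgn, len, brCoeff, brIndex, Bool.not_false, Bool.not_true, if_true,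
      Bool.false_eq_true, if_false, Prod.mk.injEq, reduceCtorEq, and_true, and_false,
      Option.some.injEq, zero_mul, ite_self, sub_zero, zero_sub, add_zero, zero_add,
      zero_div, mul_zero, neg_zero]
  all_goals try simp only [sub_self, zero_div, mul_zero, neg_zero]
  all_goals try field_simp
  · rcases eq_or_ne j k with rfl | h
    · have := ha' j
      have := hb' j
      simp only [if_true]
      field_simp
      ring
    · simp [h, h.symm]
  · rcases eq_or_ne j k with rfl | h
    · have := ha' j
      have := hb' j
      simp only [if_true]
      field_simp
      ring
    · simp [h, h.symm]
  · rcases eq_or_ne i k with rfl | h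
    · have := ha' i
      have := hb' i
      simp only [if_true, hda]
      field_simp
      ring
    · simp [h, h.symm]
  · rcases eq_or_ne i k with rfl | h
    · have := ha' i
      have := hb' i
      simp only [if_true, hda]
      field_simp
      ring
    · simp [h, h.symm]
  · rcases eq_or_ne i j with rfl | h
    · have := ha' i
      have := hb' i
      simp only [if_true, hda]
      field_simp
      ring
    · simp [h, h.symm]
  · rcases eq_or_ne i j with rfl | h
    · have := ha' i
      have := hb' i
      simp only [if_true, hda]
      field_simp
      ring
    · simp [h, h.symm]
  · rcases eq_or_ne i k with rfl | h
    · have := ha' i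
      have := hb' i
      simp only [if_true, hdb]
      field_simp
      ring
    · simp [h, h.symm]
  · rcases eq_or_ne i k with rfl | h
    · have := ha' i
      have := hb' i
      simp only [if_true, hdb]
      field_simp
      ring
    · simp [h, h.symm]
  · rcases eq_or_ne i j with rfl | h
    · have := ha' i
      have := hb' i
      simp only [if_true, hdb]
      field_simp
      ring
    · simp [h, h.symm]
  · rcases eq_or_ne i j with rfl | h
    · have := ha' i
      have := hb' i
      simp only [if_true, hdb]
      field_simp
      ring
    · simp [h, h.symm]

lemma sgn_star (p : Option (Fin n) × Bool) : sgn (star p) = -sgn p := by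
  rcases p with ⟨_, _ | _⟩ <;> simp [sgn, star]

lemma sgn_mul_self (p : Option (Fin n) × Bool) : sgn p * sgn p = 1 := by
  rcases p with ⟨_, _ | _⟩ <;> simp [sgn]

lemma star_star (p : Option (Fin n) × Bool) : star (star p) = p := by
  simp [star]

lemma star_eq_iff (p q : Option (Fin n) × Bool) : star p = q ↔ p = star q :=
  ⟨fun h ↦ by rw [← h, star_star], fun h ↦ by rw [h, star_star]⟩

/-! ### The Kähler property. -/

namespace IsDiagonalCohomOne

variable (hM : IsDiagonalCohomOne n g I' G U S t T Z X Y Γz Γx Γy a b c J)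
include hM

lemma ext_rawFrame {A : Type*} [AddCommGroup A] [Module ℝ A] [TopologicalSpace A] (hx : x ∈ U)
    {K L : TangentSpace I x →L[ℝ] A}
    (h : ∀ p, K (rawFrame T Z X Y p x) = L (rawFrame T Z X Y p x)) (v : TangentSpace I x) :
    K v = L v := by
  rw [← hM.isOrthonormalFrameOn.sum_inner_smul hx v]
  simp only [map_sum, map_smul, unitFrame_apply, h]

lemma J_J (hx : x ∈ U) (v : TangentSpace I x) : J x (J x v) = -v := by
  have he := hM.isOrthonormalFrameOn
  rw [← he.sum_inner_smul hx v]
  simp only [map_sum, map_smul, ← Finset.sum_neg_distrib]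
  refine Finset.sum_congr rfl fun p _ ↦ ?_
  rw [hM.J_unitFrame p hx, map_smul, hM.J_unitFrame (star p) hx, star_star, smul_smul, smul_smul,
    sgn_star, mul_assoc, mul_neg, sgn_mul_self, mul_neg_one, neg_smul]

lemma J_orthogonal (hx : x ∈ U) (v w : TangentSpace I x) :
    g.inner x (J x v) (J x w) = g.inner x v w := by
  have he := hM.isOrthonormalFrameOn
  have h (p q : Option (Fin n) × Bool) :
      g.inner x (J x (unitFrame t T Z X Y a b c p x)) (J x (unitFrame t T Z X Y a b c q x))
        = if p = q then 1 else 0 := by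
    rw [hM.J_unitFrame p hx, hM.J_unitFrame q hx]
    simp only [map_smul, smul_apply, he.inner x hx, smul_eq_mul, star_eq_iff, star_star]
    split_ifs with hpq
    · rw [hpq, mul_one, sgn_mul_self]
    · simp
  conv_lhs => rw [← he.sum_inner_smul hx v, ← he.sum_inner_smul hx w]
  conv_rhs => rw [← he.sum_inner_smul hx v, ← he.sum_inner_smul hx w]
  simp only [map_sum, map_smul, sum_apply, smul_apply, h, he.inner x hx]

lemma inner_J_unitFrame (hx : x ∈ U) (v : TangentSpace I x) (p : Option (Fin n) × Bool) :
    g.inner x (J x v) (unitFrame t T Z X Y a b c p x)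
      = -(sgn p * g.inner x v (unitFrame t T Z X Y a b c (star p) x)) := by
  have h := hM.J_orthogonal hx v (J x (unitFrame t T Z X Y a b c p x))
  rw [hM.J_J hx, hM.J_unitFrame p hx] at h
  simp only [map_neg, map_smul, smul_eq_mul] at h
  linarith

lemma J_smooth (hx : x ∈ U) {V : Π x : M, TangentSpace I x} (hV : CMDiffAt ∞ (T% V) x) :
    CMDiffAt ∞ (T% (fun y ↦ J y (V y))) x := by
  have he := hM.isOrthonormalFrameOn
  refine contMDiffAt_of_inner he hx fun p ↦ ?_
  have h : CMDiffAt ∞ (fun y ↦ -(sgn p * g.inner y (V y) (unitFrame t T Z X Y a b c (star p) y))) x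
    := (contMDiffAt_const.mul (contMDiffAt_inner hV (he.smoothAt hx _))).neg
  refine h.congr_of_eventuallyEq ?_
  filter_upwards [hM.isOpen_U.mem_nhds hx] with y hy using hM.inner_J_unitFrame hy _ _

/-- The map `V ↦ ∇(JV) - J∇V` is tensorial, so it is enough to test it on the unit frame, where `J`
only permutes vectors up to constant signs and `connNum_star` applies. -/
lemma isKahlerOn (hcov : IsLeviCivita g cov)
    (hda : ∀ i, ∀ s ∈ S, deriv (a i) s =
      prodAB a b s / (2 * b i s) * (Γz i * c s ^ 2 - Γx i * a i s ^ 2 + Γy i * b i s ^ 2))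
    (hdb : ∀ i, ∀ s ∈ S, deriv (b i) s =
      prodAB a b s / (2 * a i s) * (Γz i * c s ^ 2 + Γx i * a i s ^ 2 - Γy i * b i s ^ 2)) :
    IsKahlerOn g cov J U where
  sq _ hx v := hM.J_J hx v
  orthogonal _ hx v w := hM.J_orthogonal hx v w
  smooth _ hx _ hV := hM.J_smooth hx hV
  parallel x hx V hV v := by
    have he := hM.isOrthonormalFrameOn
    have hs := hM.mem_S hx
    have hframe (q : Option (Fin n) × Bool) (v : TangentSpace I x) :
        cov (fun y ↦ J y (unitFrame t T Z X Y a b c q y)) x v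
          = J x (cov (unitFrame t T Z X Y a b c q) x v) := by
      have hJq := hM.J_smooth hx (he.smoothAt hx q)
      have hc : CMDiffAt ∞ (fun _ : M ↦ sgn q) x := contMDiffAt_const
      have h1 : cov (fun y ↦ J y (unitFrame t T Z X Y a b c q y)) x
          = sgn q • cov (unitFrame t T Z X Y a b c (star q)) x := by
        rw [cov_congr (mdiffAt_of_smooth hJq)
          (mdiffAt_of_smooth (hc.smul_section (he.smoothAt hx (star q)))) (by
          filter_upwards [hM.isOpen_U.mem_nhds hx] with y hy using hM.J_unitFrame q hy)]
        ext u
        rw [cov_smul (mdiffAt_fun_of_smooth hc) (mdiffAt_of_smooth (he.smoothAt hx _)),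
          mvfderiv_const]
        simp
      rw [h1]
      refine hM.ext_rawFrame hx (L := J x ∘L cov (unitFrame t T Z X Y a b c q) x) (fun p ↦ ?_) v
      refine he.ext_inner hx fun r ↦ ?_
      have h2 := connNum_star (hM.prodAB_pos hs) (fun i ↦ hM.a_pos i _ hs)
        (fun i ↦ hM.b_pos i _ hs) (hM.c_pos _ hs) (fun i ↦ hda i _ hs) (fun i ↦ hdb i _ hs) p q r
      simp only [ContinuousLinearMap.comp_apply, hM.inner_J_unitFrame hx, smul_apply, map_smul,
        smul_eq_mul, hM.inner_cov_unitFrame hcov hx, h2]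
    have hΦ : SmoothTensorialAt
        (fun V ↦ cov (fun y ↦ J y (V y)) x v - J x (cov V x v)) x := by
      constructor
      · intro V W hV hW
        have h1 : (fun y ↦ J y ((V + W) y)) = (fun y ↦ J y (V y)) + fun y ↦ J y (W y) := by
          funext y; simp
        simp only [h1]
        rw [cov_add (mdiffAt_of_smooth (hM.J_smooth hx hV))
          (mdiffAt_of_smooth (hM.J_smooth hx hW)),
          cov_add (mdiffAt_of_smooth hV) (mdiffAt_of_smooth hW)]
        simp only [add_apply, map_add]
        abel
      · intro f V hf hV
        have h1 : (fun y ↦ J y ((f • V) y)) = f • (fun y ↦ J y (V y)) := by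
          funext y; simp
        simp only [h1]
        rw [cov_smul (mdiffAt_fun_of_smooth hf) (mdiffAt_of_smooth (hM.J_smooth hx hV)),
          cov_smul (mdiffAt_fun_of_smooth hf) (mdiffAt_of_smooth hV)]
        simp only [map_add, map_smul]
        module
    have := hΦ.eq_sum he hx hV
    simp only [hframe, sub_self, smul_zero, Finset.sum_const_zero] at this
    exact sub_eq_zero.1 this

end IsDiagonalCohomOne

/-! ### The skew-soliton equation. -/

namespace IsDiagonalCohomOne

variable (hM : IsDiagonalCohomOne n g I' G U S t T Z X Y Γz Γx Γy a b c J)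
include hM

/-- The form `θ` is a multiple of `ζ`. The term with `c'` comes from the plane of `T, Z`, each
summand from a plane of `X_i, Y_i`. -/
lemma connForm_rawFrame (hcov : IsLeviCivita g cov) (hx : x ∈ U) (p : Option (Fin n) × Bool) :
    connForm g cov J (unitFrame t T Z X Y a b c) x (rawFrame T Z X Y p x) =
      if p = (none, true) then 2 * (deriv c (t x) / (prodAB a b (t x) * c (t x))
        + ∑ i, (Γz i * c (t x) ^ 2 - Γx i * a i (t x) ^ 2 - Γy i * b i (t x) ^ 2)
          / (2 * a i (t x) * b i (t x))) else 0 := by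
  have hP := (hM.prodAB_pos (hM.mem_S hx)).ne'
  have hc := (hM.c_pos _ (hM.mem_S hx)).ne'
  have ha (i) := (hM.a_pos i _ (hM.mem_S hx)).ne'
  have hb (i) := (hM.b_pos i _ (hM.mem_S hx)).ne'
  simp only [connForm, hM.J_unitFrame _ hx, map_smul, smul_eq_mul,
    hM.inner_cov_unitFrame hcov hx, Fintype.sum_prod_type, Fintype.sum_option, Fintype.sum_bool]
  rcases p with ⟨_ | i, _ | _⟩ <;>
    simp only [connNum, star, sgn, len, brCoeff, brIndex, Bool.not_false, Bool.not_true, if_true,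
      Bool.false_eq_true, if_false, Prod.mk.injEq, reduceCtorEq, and_true, and_false,
      Option.some.injEq, zero_mul, ite_self, sub_zero, zero_sub, add_zero, zero_add,
      zero_div, mul_zero, sub_self, Finset.sum_const_zero]
  rw [mul_add, Finset.mul_sum]
  congr 1
  · field_simp
    ring
  · refine Finset.sum_congr rfl fun i _ ↦ ?_
    have := ha i
    have := hb i
    field_simp
    ring

lemma J_rawFrame (p : Option (Fin n) × Bool) (hx : x ∈ U) :
    J x (rawFrame T Z X Y p x) = (sgn p * (len a b c p (t x) / len a b c (star p) (t x))) •
      rawFrame T Z X Y (star p) x := by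
  rw [hM.rawFrame_apply p hx, map_smul, hM.J_unitFrame p hx, unitFrame_apply, smul_smul, smul_smul]
  congr 1
  ring

/-- `g(J∇F, v) = -dF(Jv)`, and among the frame vectors only `JZ` has a component along `T`. -/
lemma inner_J_grad {F : ℝ → ℝ} (hF : ContDiffOn ℝ ∞ F S) (hx : x ∈ U)
    (p : Option (Fin n) × Bool) :
    g.inner x (J x (grad g (fun y ↦ F (t y)) x)) (rawFrame T Z X Y p x) =
      if p = (none, true) then deriv F (t x) / prodAB a b (t x) else 0 := by
  have hP := (hM.prodAB_pos (hM.mem_S hx)).ne'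
  have hc := (hM.c_pos _ (hM.mem_S hx)).ne'
  have h := hM.J_orthogonal hx (grad g (fun y ↦ F (t y)) x) (J x (rawFrame T Z X Y p x))
  rw [hM.J_J hx, inner_grad, hM.dir_comp hF hx, hM.J_rawFrame p hx] at h
  simp only [map_neg, map_smul, smul_eq_mul, hM.dt_rawFrame _ hx] at h
  rw [← neg_eq_iff_eq_neg.2 h.symm]
  rcases p with ⟨_ | i, _ | _⟩ <;> simp [star, sgn, len]
  field_simp

lemma dir_ite {φ : ℝ → ℝ} (hφ : ContDiffOn ℝ ∞ φ S) (hx : x ∈ U) {ψ : M → ℝ} {P : Prop}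
    [Decidable P] (hψ : ∀ y ∈ U, ψ y = if P then φ (t y) else 0) (v : TangentSpace I x) :
    d% ψ x v = if P then deriv φ (t x) * d% t x v else 0 := by
  rw [mvfderiv_congr (f₂ := fun y ↦ if P then φ (t y) else 0) (by
    filter_upwards [hM.isOpen_U.mem_nhds hx] with y hy using hψ y hy)]
  split_ifs
  · exact hM.dir_comp hφ hx v
  · rw [mvfderiv_const]; rfl

/-- The equation for `c'` identifies `η` with `φ ζ`; then `dη = λω` is checked on pairs of frame
fields, where only `(T,Z)` and `(X_i,Y_i)` matter. The index `i₀` merely fixes one expression for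
`φ`. -/
lemma isSkewSolitonOn (hcov : IsLeviCivita g cov) (i₀ : Fin n) (hJ : IsKahlerOn g cov J U)
    {F : ℝ → ℝ} (hF : ContDiffOn ℝ ∞ F S) {lam : ℝ} (hΓ : Γz i₀ ≠ 0)
    (hK3 : ∀ s ∈ S, deriv (a i₀) s / a i₀ s + deriv (b i₀) s / b i₀ s
      = Γz i₀ * (alpha a b c s * c s / (a i₀ s * b i₀ s)))
    (hunif : ∀ i, ∀ s ∈ S, Γz i * (a i s * b i s)⁻¹ = Γz i₀ * (a i₀ s * b i₀ s)⁻¹)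
    (h1 : ∀ s ∈ S, deriv c s / c s
      = alpha a b c s *
          ((∑ j, 1 / (2 * a j s * b j s) *
              (1 / c s * (Γx j * a j s ^ 2 + Γy j * b j s ^ 2) - Γz j * c s))
            - lam / Γz i₀ * (a i₀ s * b i₀ s / c s))
        + 1 / 2 * deriv F s) :
    IsSkewSolitonOn g cov J (fun x ↦ F (t x)) lam U := by
  -- Forced by the `(X_i,Y_i)` component of `dη = λω`, namely `Γ_ii^z φ = λ a_i b_i`.
  let φ : ℝ → ℝ := fun s ↦ lam / Γz i₀ * (a i₀ s * b i₀ s)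
  have hφ : ContDiffOn ℝ ∞ φ S :=
    contDiffOn_const.mul ((hM.a_smooth i₀).mul (hM.b_smooth i₀))
  have hdφ (s : ℝ) (hs : s ∈ S) : deriv φ s = lam * (prodAB a b s * c s ^ 2) := by
    have ha := hM.differentiableAt_of_contDiffOn (hM.a_smooth i₀) hs
    have hb := hM.differentiableAt_of_contDiffOn (hM.b_smooth i₀) hs
    have ha0 := (hM.a_pos i₀ s hs).ne'
    have hb0 := (hM.b_pos i₀ s hs).ne'
    have h := hK3 s hs
    simp only [φ]
    rw [deriv_const_mul_field, deriv_fun_mul ha hb]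
    simp only [alpha] at h
    field_simp at h ⊢
    linear_combination lam * h
  let η : Π x : M, TangentSpace I x → ℝ := fun x v ↦
    -(1 / 2) * connForm g cov J (unitFrame t T Z X Y a b c) x v
      + 1 / 2 * g.inner x (J x (grad g (fun y ↦ F (t y)) x)) v
  have hη (p : Option (Fin n) × Bool) (x : M) (hx : x ∈ U) :
      η x (rawFrame T Z X Y p x) = if p = (none, true) then φ (t x) else 0 := by
    simp only [η, hM.connForm_rawFrame hcov hx, hM.inner_J_grad hF hx]
    split_ifs with hp
    · have hs := hM.mem_S hx
      have hP := (hM.prodAB_pos hs).ne'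
      have hc := (hM.c_pos _ hs).ne'
      have hsum : ∑ i, (Γz i * c (t x) ^ 2 - Γx i * a i (t x) ^ 2 - Γy i * b i (t x) ^ 2)
          / (2 * a i (t x) * b i (t x)) = -(c (t x) * ∑ j, 1 / (2 * a j (t x) * b j (t x)) *
            (1 / c (t x) * (Γx j * a j (t x) ^ 2 + Γy j * b j (t x) ^ 2) - Γz j * c (t x))) := by
        rw [Finset.mul_sum, ← Finset.sum_neg_distrib]
        refine Finset.sum_congr rfl fun i _ ↦ ?_
        have := (hM.a_pos i _ hs).ne'
        have := (hM.b_pos i _ hs).ne'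
        field_simp
        ring
      have h := h1 (t x) hs
      rw [hsum]
      generalize (∑ j, 1 / (2 * a j (t x) * b j (t x)) *
            (1 / c (t x) * (Γx j * a j (t x) ^ 2 + Γy j * b j (t x) ^ 2) - Γz j * c (t x))) = σ
        at h ⊢
      simp only [alpha] at h
      simp only [φ]
      field_simp at h ⊢
      linear_combination -h
    · simp
  have hη_smul (x : M) (r : ℝ) (v : TangentSpace I x) : η x (r • v) = r * η x v := by
    simp only [η, connForm, map_smul, smul_apply, smul_eq_mul, ← Finset.mul_sum]
    ring
  refine hJ.isSkewSolitonOn hcov hM.isOrthonormalFrameOn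
    -- In the unit frame `J` is a signed permutation, so its matrix is constant.
    (fun p q ↦ ⟨sgn p * if q = star p then 1 else 0, fun y hy ↦ ?_⟩)
    (hM.contMDiffOn_comp hF) hM.rawFrame_smooth (fun p x ↦ (len a b c p (t x))⁻¹)
    (fun x _ p ↦ rfl) η (fun _ _ _ ↦ rfl) fun x hx p q ↦ ?_
  · rw [hM.J_unitFrame p hy, map_smul, hM.isOrthonormalFrameOn.inner y hy, smul_eq_mul]
  · have hs := hM.mem_S hx
    have hP := (hM.prodAB_pos hs).ne'
    have hc := (hM.c_pos _ hs).ne'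
    rw [hM.dir_ite hφ hx (hη q), hM.dir_ite hφ hx (hη p), hM.bracket_rawFrame p q hx, hη_smul,
      hη _ x hx, kahlerForm, hM.J_rawFrame p hx, hM.dt_rawFrame p hx, hM.dt_rawFrame q hx,
      hdφ _ hs]
    simp only [map_smul, smul_apply, smul_eq_mul, hM.inner_rawFrame _ _ hx]
    -- The `(X_i,Y_i)` component for every `i`; this is where independence of the index enters.
    have hfin (i : Fin n) : Γz i * φ (t x) = lam * (a i (t x) * b i (t x)) := by
      have h := hunif i _ hs
      have := (hM.a_pos i _ hs).ne'
      have := (hM.b_pos i _ hs).ne'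
      have := (hM.a_pos i₀ _ hs).ne'
      have := (hM.b_pos i₀ _ hs).ne'
      simp only [φ]
      field_simp at h ⊢
      linear_combination lam * h
    rcases p with ⟨_ | i, _ | _⟩ <;> rcases q with ⟨_ | j, _ | _⟩ <;>
      simp only [star, sgn, len, brCoeff, brIndex, Bool.not_false, Bool.not_true, if_true,
        Bool.false_eq_true, if_false, Prod.mk.injEq, reduceCtorEq, and_true, and_false,
        Option.some.injEq, ite_self, sub_zero, zero_sub, mul_one, one_mul, mul_zero, sub_self]
    · field_simp
    · field_simp
    · split_ifs with h
      · subst h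
        have := (hM.b_pos i _ hs).ne'
        rw [neg_mul, neg_neg, hfin]
        field_simp
      · simp
    · split_ifs with h
      · subst h
        have := (hM.a_pos i _ hs).ne'
        rw [hfin]
        field_simp
      · simp

end IsDiagonalCohomOne

/-! ### Constant ratios and the holomorphic gradient. -/

namespace IsDiagonalCohomOne

variable (hM : IsDiagonalCohomOne n g I' G U S t T Z X Y Γz Γx Γy a b c J)
include hM

/-- Half the difference of the two logarithmic equations; `deriv_b` is half their sum. -/
lemma deriv_a {i : Fin n} {s : ℝ} (hs : s ∈ S)
    (hK3 : deriv (a i) s / a i s + deriv (b i) s / b i s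
      = Γz i * (alpha a b c s * c s / (a i s * b i s)))
    (hK4 : deriv (b i) s / b i s - deriv (a i) s / a i s
      = (Γx i * (a i s / b i s) - Γy i * (b i s / a i s)) * (alpha a b c s / c s)) :
    deriv (a i) s =
      prodAB a b s / (2 * b i s) * (Γz i * c s ^ 2 - Γx i * a i s ^ 2 + Γy i * b i s ^ 2) := by
  have ha := (hM.a_pos i s hs).ne'
  have hb := (hM.b_pos i s hs).ne'
  have hc := (hM.c_pos s hs).ne'
  simp only [alpha] at hK3 hK4
  field_simp at hK3 hK4 ⊢
  linear_combination hK3 - hK4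

lemma deriv_b {i : Fin n} {s : ℝ} (hs : s ∈ S)
    (hK3 : deriv (a i) s / a i s + deriv (b i) s / b i s
      = Γz i * (alpha a b c s * c s / (a i s * b i s)))
    (hK4 : deriv (b i) s / b i s - deriv (a i) s / a i s
      = (Γx i * (a i s / b i s) - Γy i * (b i s / a i s)) * (alpha a b c s / c s)) :
    deriv (b i) s =
      prodAB a b s / (2 * a i s) * (Γz i * c s ^ 2 + Γx i * a i s ^ 2 - Γy i * b i s ^ 2) := by
  have ha := (hM.a_pos i s hs).ne'
  have hb := (hM.b_pos i s hs).ne'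
  have hc := (hM.c_pos s hs).ne'
  simp only [alpha] at hK3 hK4
  field_simp at hK3 hK4 ⊢
  linear_combination hK3 + hK4

/-- If `deriv F = k α c`, then the gradient of `F ∘ t` is `k c` times the unit normal. -/
lemma grad_eq {F : ℝ → ℝ} (hF : ContDiffOn ℝ ∞ F S) {k : ℝ}
    (hk : ∀ s ∈ S, deriv F s = k * alpha a b c s * c s) (hx : x ∈ U) :
    grad g (fun y ↦ F (t y)) x
      = ((fun y ↦ k * c (t y)) • unitFrame t T Z X Y a b c (none, false)) x := by
  have he := hM.isOrthonormalFrameOn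
  have hP := (hM.prodAB_pos (hM.mem_S hx)).ne'
  have hc := (hM.c_pos _ (hM.mem_S hx)).ne'
  refine he.ext_inner hx fun r ↦ ?_
  rw [inner_grad, hM.dir_comp hF hx, hk _ (hM.mem_S hx), unitFrame_apply, map_smul,
    hM.dt_rawFrame r hx, ← unitFrame_apply, Pi.smul_apply', map_smul, smul_apply, he.inner x hx]
  simp only [eq_comm (a := (none, false)), smul_eq_mul]
  split_ifs with h
  · subst h
    simp only [len, alpha]
    field_simp
  · simp

lemma inner_cov_grad (hcov : IsLeviCivita g cov) {F : ℝ → ℝ} (hF : ContDiffOn ℝ ∞ F S) {k : ℝ}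
    (hk : ∀ s ∈ S, deriv F s = k * alpha a b c s * c s) (hx : x ∈ U)
    (p r : Option (Fin n) × Bool) :
    g.inner x (cov (grad g (fun y ↦ F (t y))) x (rawFrame T Z X Y p x))
        (unitFrame t T Z X Y a b c r x) =
      k * c (t x) * (connNum Γz Γx Γy a b c p (none, false) r (t x)
        / (2 * (prodAB a b (t x) * c (t x)) * len a b c r (t x)))
      + if p = (none, false) ∧ r = (none, false) then k * deriv c (t x) else 0 := by
  have he := hM.isOrthonormalFrameOn
  have hkc : ContDiffOn ℝ ∞ (fun s ↦ k * c s) S := contDiffOn_const.mul hM.c_smooth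
  have hs := (hM.contMDiffOn_comp hkc).contMDiffAt (hM.isOpen_U.mem_nhds hx)
  have he0 := he.smoothAt hx (none, false)
  rw [cov_congr (mdiffAt_of_smooth (contMDiffAt_grad he hx (hM.contMDiffOn_comp hF)))
    (mdiffAt_of_smooth (hs.smul_section he0)) (by
      filter_upwards [hM.isOpen_U.mem_nhds hx] with y hy using hM.grad_eq hF hk hy),
    cov_smul (mdiffAt_fun_of_smooth hs) (mdiffAt_of_smooth he0), hM.dir_comp hkc hx,
    deriv_const_mul_field, hM.dt_rawFrame p hx]
  simp only [map_add, map_smul, add_apply, smul_apply, smul_eq_mul,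
    hM.inner_cov_unitFrame hcov hx, he.inner x hx, eq_comm (a := (none, false))]
  congr 1
  by_cases hp : p = (none, false) <;> by_cases hr : r = (none, false) <;> simp [hp, hr]

/-- The covariant derivative of `∇F` is diagonal in the unit frame, with eigenvalue `kc'/(∏ a_j b_j
· c)` on the plane of `T, Z` and `k Γ_ii^z c²/(2 a_i b_i)` on that of `X_i, Y_i`. The equality on
the latter plane is where `a_i'/a_i = b_i'/b_i` is needed; it is built into `hda` and `hdb`. -/
lemma cov_grad_J (hcov : IsLeviCivita g cov) {F : ℝ → ℝ} (hF : ContDiffOn ℝ ∞ F S) {k : ℝ}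
    (hk : ∀ s ∈ S, deriv F s = k * alpha a b c s * c s)
    (hda : ∀ i, ∀ s ∈ S, deriv (a i) s = prodAB a b s / (2 * b i s) * (Γz i * c s ^ 2))
    (hdb : ∀ i, ∀ s ∈ S, deriv (b i) s = prodAB a b s / (2 * a i s) * (Γz i * c s ^ 2))
    (hx : x ∈ U) (p : Option (Fin n) × Bool) :
    cov (grad g (fun y ↦ F (t y))) x (J x (unitFrame t T Z X Y a b c p x))
      = J x (cov (grad g (fun y ↦ F (t y))) x (unitFrame t T Z X Y a b c p x)) := by
  have hs := hM.mem_S hx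
  have hP := (hM.prodAB_pos hs).ne'
  have hc := (hM.c_pos _ hs).ne'
  refine hM.isOrthonormalFrameOn.ext_inner hx fun r ↦ ?_
  rw [hM.inner_J_unitFrame hx, hM.J_unitFrame p hx, unitFrame_apply (star p), unitFrame_apply p]
  simp only [map_smul, smul_apply, smul_eq_mul, hM.inner_cov_grad hcov hF hk hx]
  rcases p with ⟨_ | i, _ | _⟩ <;> rcases r with ⟨_ | j, _ | _⟩ <;>
    simp only [connNum, star, sgn, len, brCoeff, brIndex, Bool.not_false, Bool.not_true, if_true,
      Bool.false_eq_true, if_false, Prod.mk.injEq, reduceCtorEq, and_true, and_false,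
      Option.some.injEq, ite_self, sub_zero, add_zero, zero_add, zero_mul,
      zero_div, mul_zero, neg_zero, sub_self, one_mul]
  · field_simp
  · field_simp
  · rcases eq_or_ne i j with rfl | h
    · have := (hM.a_pos i _ hs).ne'
      have := (hM.b_pos i _ hs).ne'
      simp only [if_true, hda i _ hs, hdb i _ hs]
      field_simp
    · simp [h]
  · rcases eq_or_ne i j with rfl | h
    · have := (hM.a_pos i _ hs).ne'
      have := (hM.b_pos i _ hs).ne'
      simp only [if_true, hda i _ hs, hdb i _ hs]
      field_simp
    · simp [h]

/-- Two functions whose ratio has vanishing logarithmic derivative on `S` are proportional. -/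
lemma exists_ratio {i : Fin n}
    (h : ∀ s ∈ S, deriv (b i) s / b i s - deriv (a i) s / a i s = 0) :
    ∃ l : ℝ, 0 < l ∧ ∀ s ∈ S, b i s = l * a i s := by
  obtain ⟨s₀, hs₀⟩ := hM.nonempty_S
  have ha (s) (hs : s ∈ S) := hM.differentiableAt_of_contDiffOn (hM.a_smooth i) hs
  have hb (s) (hs : s ∈ S) := hM.differentiableAt_of_contDiffOn (hM.b_smooth i) hs
  refine ⟨b i s₀ / a i s₀, div_pos (hM.b_pos i _ hs₀) (hM.a_pos i _ hs₀), fun s hs ↦ ?_⟩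
  have hd : S.EqOn (deriv (fun s ↦ b i s / a i s)) 0 := fun r hr ↦ by
    have ha0 := (hM.a_pos i r hr).ne'
    have hb0 := (hM.b_pos i r hr).ne'
    have h' := h r hr
    rw [deriv_fun_div (hb r hr) (ha r hr) ha0, Pi.zero_apply, div_eq_zero_iff]
    left
    field_simp at h'
    linear_combination h'
  have hconst := hM.isOpen_S.is_const_of_deriv_eq_zero hM.interval_S.isPreconnected
    (fun r hr ↦ ((hb r hr).fun_div (ha r hr) (hM.a_pos i r hr).ne').differentiableWithinAt) hd hs hs₀
  rw [← hconst, div_mul_cancel₀ _ (hM.a_pos i s hs).ne']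

end IsDiagonalCohomOne

end Diagonal

end KRSkew

end

/-! ### Assembly of the three statements. -/

open KRSkew in
theorem proposition4p1
    {E : Type*} [NormedAddCommGroup E] [NormedSpace ℝ E] [FiniteDimensional ℝ E]
    {H : Type*} [TopologicalSpace H] {I : ModelWithCorners ℝ E H} [I.Boundaryless]
    {M : Type*} [TopologicalSpace M] [ChartedSpace H M] [IsManifold I ∞ M]
    {E' : Type*} [NormedAddCommGroup E'] [NormedSpace ℝ E']
    {H' : Type*} [TopologicalSpace H'] {I' : ModelWithCorners ℝ E' H'}
    {G : Type*} [TopologicalSpace G] [ChartedSpace H' G] [Group G] [MulAction G M]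
    (n : ℕ) (hn : 1 ≤ n)
    (g : ContMDiffRiemannianMetric I ∞ E (fun x : M ↦ TangentSpace I x))
    (cov : CovariantDerivative I E (fun x : M ↦ TangentSpace I x)) (hcov : IsLeviCivita g cov)
    (U : Set M) (S : Set ℝ) (t : M → ℝ)
    (T Z : Π x : M, TangentSpace I x) (X Y : Fin n → Π x : M, TangentSpace I x)
    (Γz Γx Γy : Fin n → ℝ) (a b : Fin n → ℝ → ℝ) (c : ℝ → ℝ)
    (J : Π x : M, TangentSpace I x →L[ℝ] TangentSpace I x)
    (hM : IsDiagonalCohomOne n g I' G U S t T Z X Y Γz Γx Γy a b c J)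
    (τ : ℝ → ℝ) (hτ : ∀ s ∈ S, HasDerivAt τ (√2 * (prodAB a b s * c s)) s)
    (f : ℝ → ℝ) (hf : ContDiffOn ℝ ∞ f (τ '' S))
    (lam : ℝ) (hlam : lam ≠ 0) (hΓ : ∀ i, Γz i ≠ 0)
    (hK3 : ∀ i, ∀ s ∈ S, deriv (a i) s / a i s + deriv (b i) s / b i s
      = Γz i * (alpha a b c s * c s / (a i s * b i s)))
    (hK4 : ∀ i, ∀ s ∈ S, deriv (b i) s / b i s - deriv (a i) s / a i s
      = (Γx i * (a i s / b i s) - Γy i * (b i s / a i s)) * (alpha a b c s / c s))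
    (hunif : ∀ i j, ∀ s ∈ S, Γz i * (a i s * b i s)⁻¹ = Γz j * (a j s * b j s)⁻¹)
    (h1 : ∀ i, ∀ s ∈ S, deriv c s / c s
      = alpha a b c s *
          ((∑ j, 1 / (2 * a j s * b j s) *
              (1 / c s * (Γx j * a j s ^ 2 + Γy j * b j s ^ 2) - Γz j * c s))
            - lam / Γz i * (a i s * b i s / c s))
        + 1 / 2 * deriv (fun r ↦ f (τ r)) s) :
    IsSkewSolitonOn g cov J (fun x ↦ f (τ (t x))) lam U ∧
    ∀ k : ℝ,
      (∀ i, ∀ s ∈ S, Γx i * a i s ^ 2 - Γy i * b i s ^ 2 = 0) →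
      (∀ s ∈ S, deriv (fun r ↦ f (τ r)) s = k * alpha a b c s * c s) →
      (∃ l : Fin n → ℝ,
        (∀ i, 0 < l i ∧ (∀ s ∈ S, b i s = l i * a i s) ∧ Γx i - l i ^ 2 * Γy i = 0) ∧
        (∀ i, ∀ s ∈ S, deriv c s / c s
          = alpha a b c s *
              ((∑ j, 1 / (2 * l j * a j s ^ 2) *
                  (2 / c s * Γx j * a j s ^ 2 - Γz j * c s))
                - lam / Γz i * (l i * a i s ^ 2 / c s) + 1 / 2 * k * c s)) ∧
        (∀ i, ∀ s ∈ S, deriv (a i) s / a i s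
          = Γz i / 2 * (alpha a b c s * c s / (l i * a i s ^ 2)))) ∧
      ((∀ r ∈ τ '' S, deriv f r = 0 → deriv (deriv f) r = 0) →
        IsKahlerRicciSolitonOn g cov J (fun x ↦ f (τ (t x))) lam U) := by
  -- The prescribed derivative of `τ` is smooth on the open set `S`, hence so is `τ`.
  have hτs : ContDiffOn ℝ ∞ τ S := by
    rw [contDiffOn_infty_iff_deriv_of_isOpen hM.isOpen_S]
    refine ⟨fun s hs ↦ (hτ s hs).differentiableAt.differentiableWithinAt, ?_⟩
    refine ContDiffOn.congr (f := fun s ↦ √2 * (prodAB a b s * c s)) ?_ fun s hs ↦ (hτ s hs).deriv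
    exact contDiffOn_const.mul (hM.prodAB_smooth.mul hM.c_smooth)
  have hF : ContDiffOn ℝ ∞ (fun r ↦ f (τ r)) S := hf.comp hτs (mapsTo_image τ S)
  have hda (i : Fin n) (s : ℝ) (hs : s ∈ S) := hM.deriv_a hs (hK3 i s hs) (hK4 i s hs)
  have hdb (i : Fin n) (s : ℝ) (hs : s ∈ S) := hM.deriv_b hs (hK3 i s hs) (hK4 i s hs)
  let i₀ : Fin n := ⟨0, hn⟩
  have hskew : IsSkewSolitonOn g cov J (fun x ↦ f (τ (t x))) lam U :=
    hM.isSkewSolitonOn hcov i₀ (hM.isKahlerOn hcov hda hdb) hF (hΓ i₀) (hK3 i₀)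
      (fun i s hs ↦ hunif i i₀ s hs) (h1 i₀)
  refine ⟨hskew, fun k hΓab hk ↦ ⟨?_, fun _ ↦ ?_⟩⟩
  · have hratio (i : Fin n) : ∃ l : ℝ, 0 < l ∧ ∀ s ∈ S, b i s = l * a i s := by
      refine hM.exists_ratio fun s hs ↦ ?_
      have ha := (hM.a_pos i s hs).ne'
      have hb := (hM.b_pos i s hs).ne'
      have h0 : Γx i * (a i s / b i s) - Γy i * (b i s / a i s) = 0 := by
        have h := hΓab i s hs
        field_simp
        linear_combination h
      rw [hK4 i s hs, h0, zero_mul]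
    choose l hl hbl using hratio
    refine ⟨l, fun i ↦ ⟨hl i, hbl i, ?_⟩, fun i s hs ↦ ?_, fun i s hs ↦ ?_⟩
    · obtain ⟨s, hs⟩ := hM.nonempty_S
      have h := hΓab i s hs
      rw [hbl i s hs] at h
      have ha := (hM.a_pos i s hs).ne'
      refine (mul_eq_zero.1 (?_ : (Γx i - l i ^ 2 * Γy i) * a i s ^ 2 = 0)).resolve_right
        (pow_ne_zero 2 ha)
      linear_combination h
    · have hsum : ∑ j, 1 / (2 * a j s * b j s) *
            (1 / c s * (Γx j * a j s ^ 2 + Γy j * b j s ^ 2) - Γz j * c s)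
          = ∑ j, 1 / (2 * l j * a j s ^ 2) * (2 / c s * Γx j * a j s ^ 2 - Γz j * c s) := by
        refine Finset.sum_congr rfl fun j _ ↦ ?_
        -- The two terms merge into `2 Γ_jz^j a_j²`, which accounts for the factor `2 / c`.
        rw [show Γy j * b j s ^ 2 = Γx j * a j s ^ 2 by linear_combination -hΓab j s hs,
          hbl j s hs]
        ring
      rw [h1 i s hs, hsum, hk s hs, hbl i s hs]
      ring
    · have ha := (hM.a_pos i s hs).ne'
      have hl' := (hl i).ne'
      have hΓ' := hΓab i s hs
      rw [hda i s hs]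
      rw [hbl i s hs] at hΓ' ⊢
      simp only [alpha]
      field_simp
      linear_combination (-(prodAB a b s)) * hΓ'
  · refine hskew.isKahlerRicciSolitonOn hcov hM.isOrthonormalFrameOn fun x hx p ↦
      hM.cov_grad_J hcov hF hk (fun i s hs ↦ ?_) (fun i s hs ↦ ?_) hx p
    -- The relation `Γ_iz^i a_i² = Γ_zi^i b_i²` removes all but the `Γ_ii^z` term from `a_i'`, and
    -- likewise from `b_i'`.
    · rw [hda i s hs]
      linear_combination (-(prodAB a b s / (2 * b i s))) * hΓab i s hs
    · rw [hdb i s hs]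
      linear_combination (prodAB a b s / (2 * a i s)) * hΓab i s hs
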